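/- Let $n\ge 2$, let $(\overline M^{n+1},\overline g)$ be a semi-Riemannian manifold of constant sectional curvature $c$, and let $\overline V$ be a conformal vector field on $\overline M$ with conformal factor $\sigma\in C^\infty(\overline M)$, that is, $\mathcal L_{\overline V}\,\overline g=2\sigma\,\overline g$. Let $(M^n,g)$ be a connected Riemannian manifold, $f:M\to\overline M$ an isometric immersion, and $N$ a smooth field of unit normal vectors along $f$, with $\epsilon_N=\overline g(N,N)=\pm1$. Let $\mathcal A$ be the Weingarten operator, $\overline\nabla_XN=-df(\mathcal AX)$, and let $H=\epsilon_N\frac1n\operatorname{tr}\mathcal A$ be the mean curvature function. Suppose that the immersion is totally umbilic: at every point its second fundamental form $(X,Y)\mapsto g(\mathcal AX,Y)$ is proportional to $g$ (equivalently $\mathcal A=\epsilon_NH\,I$). Then $k=c+\epsilon_NH^2$ and $b=-(N\sigma+\epsilon_N\,\sigma H)$ are constant on $M$, where $\sigma$ is evaluated along $f$ and $N\sigma=d\sigma(N)$, and the angle function $C=\overline g(\overline V,N)$ satisfies $$\operatorname{Hess} C=(-kC+b)\,g$$ on $M$. That is, the smooth function $C$ is a special scalar concircular field on $(M,g)$.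 -/

import Mathlib

open scoped Manifold ContDiff

noncomputable section

namespace SemiRiem

/-! ### Semi-Riemannian calculus on an open set of a finite-dimensional vector space

`G y` is the Gram form of a metric at the point `y`; a vector field is a map `E → E`. -/

section Coordinates

variable {E F : Type*} [NormedAddCommGroup E] [NormedSpace ℝ E]
  [NormedAddCommGroup F] [NormedSpace ℝ F]

/-- The Christoffel symbols of the first kind:
`christoffelLower G y u v w = ½ (∂_u G(v,w) + ∂_v G(u,w) - ∂_w G(u,v))`. -/
def christoffelLower (G : E → E →L[ℝ] E →L[ℝ] ℝ) (y u v : E) : E →L[ℝ] ℝ :=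
  (1 / 2 : ℝ) • (fderiv ℝ G y u v + fderiv ℝ G y v u - ((fderiv ℝ G y).flip u).flip v)

/-- The Christoffel symbols of the second kind, i.e. the vector `Γ(u,v)` with
`G(Γ(u,v), w) = christoffelLower G y u v w` for all `w` (here `G y` is nondegenerate, and
`(G y).inverse` is the inverse of the isomorphism `G y` from `E` onto its dual). The Levi-Civita
connection of `G` is `∇_u Y = D_u Y + Γ(u, Y)`. -/
def christoffel (G : E → E →L[ℝ] E →L[ℝ] ℝ) (y u v : E) : E :=
  (G y).inverse (christoffelLower G y u v)

/-- The Riemann curvature `R(u,v)w = ∇_u ∇_v w - ∇_v ∇_u w` for constant fields `u`, `v`, `w`. -/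
def riemann (G : E → E →L[ℝ] E →L[ℝ] ℝ) (y u v w : E) : E :=
  fderiv ℝ (fun z => christoffel G z v w) y u - fderiv ℝ (fun z => christoffel G z u w) y v
    + christoffel G y u (christoffel G y v w) - christoffel G y v (christoffel G y u w)

/-- The determinant `G(u,u) G(v,v) - G(u,v)²` of the restriction of `G` to the span of `u`, `v`. -/
def planeDet (G : E → E →L[ℝ] E →L[ℝ] ℝ) (y u v : E) : ℝ :=
  G y u u * G y v v - G y u v ^ 2

/-- The sectional curvature of the plane spanned by `u` and `v`
(meaningful if `planeDet G y u v ≠ 0`). -/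
def sectional (G : E → E →L[ℝ] E →L[ℝ] ℝ) (y u v : E) : ℝ :=
  G y (riemann G y u v v) u / planeDet G y u v

/-- The Hessian `Hess φ (u,v) = D²φ(u,v) - dφ(Γ(u,v))`, that is, `u(v φ) - (∇_u v) φ` for constant
fields `u`, `v`. -/
def hessian (G : E → E →L[ℝ] E →L[ℝ] ℝ) (φ : E → ℝ) (y u v : E) : ℝ :=
  fderiv ℝ (fderiv ℝ φ) y u v - fderiv ℝ φ y (christoffel G y u v)

/-- The Lie derivative of the metric, `(L_V G)(u,w) = V(G(u,w)) - G([V,u],w) - G(u,[V,w])`,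
for constant fields `u`, `w` (for which `[V,u] = -D_u V`). -/
def lieDerivMetric (G : E → E →L[ℝ] E →L[ℝ] ℝ) (V : E → E) (y u w : E) : ℝ :=
  fderiv ℝ G y (V y) u w + G y (fderiv ℝ V y u) w + G y u (fderiv ℝ V y w)

/-- The covariant derivative `∇̄_u N` of a vector field `N` along a map `f : E → F`, for the
Levi-Civita connection of the metric `Gbar` on `F`. -/
def covAlong (Gbar : F → F →L[ℝ] F →L[ℝ] ℝ) (f N : E → F) (y u : E) : F :=
  fderiv ℝ N y u + christoffel Gbar (f y) (fderiv ℝ f y u) (N y)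

/-- The second fundamental form in direction of the normal field `N` along `f`. By the formula of
Weingarten it is `II(u,v) = -gbar(∇̄_u N, df v)`, which equals `gbar(α(u,v), N)`. -/
def secondForm (Gbar : F → F →L[ℝ] F →L[ℝ] ℝ) (f N : E → F) (y u v : E) : ℝ :=
  - Gbar (f y) (covAlong Gbar f N y u) (fderiv ℝ f y v)

/-- The value `A u` of the Weingarten operator, defined by `g(A u, v) = II(u,v)` for all `v`. -/
def weingarten (G : E → E →L[ℝ] E →L[ℝ] ℝ) (Gbar : F → F →L[ℝ] F →L[ℝ] ℝ) (f N : E → F)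
    (y u : E) : E :=
  (G y).inverse (-((Gbar (f y) (covAlong Gbar f N y u)).comp (fderiv ℝ f y)))

end Coordinates

/-! ### Tensors and fields on a manifold, read in charts -/

section Manifolds

/-- The model space `ℝⁿ`. -/
abbrev Eu (n : ℕ) : Type := EuclideanSpace ℝ (Fin n)

variable {n m : ℕ}
  {M : Type*} [TopologicalSpace M] [ChartedSpace (Eu n) M]
  {M' : Type*} [TopologicalSpace M'] [ChartedSpace (Eu m) M']

/-- Smooth Riemannian metrics. -/
abbrev RiemannianMetric (n : ℕ) (M : Type*) [TopologicalSpace M] [ChartedSpace (Eu n) M]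
    [IsManifold (𝓡 n) ∞ M] :=
  Bundle.ContMDiffRiemannianMetric (𝓡 n) ∞ (Eu n) (fun x : M => TangentSpace (𝓡 n) x)

/-- Smooth semi-Riemannian metrics: smooth symmetric nondegenerate `(0,2)`-tensor fields
(the index is then automatically locally constant). -/
structure SemiRiemannianMetric (n : ℕ) (M : Type*) [TopologicalSpace M] [ChartedSpace (Eu n) M]
    [IsManifold (𝓡 n) ∞ M] where
  /-- The scalar product on each tangent space. -/
  inner (x : M) : TangentSpace (𝓡 n) x →L[ℝ] TangentSpace (𝓡 n) x →L[ℝ] ℝ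
  symm (x : M) (v w : TangentSpace (𝓡 n) x) : inner x v w = inner x w v
  nondegenerate (x : M) (v : TangentSpace (𝓡 n) x) : (∀ w, inner x v w = 0) → v = 0
  contMDiff : ContMDiff (𝓡 n) ((𝓡 n).prod 𝓘(ℝ, Eu n →L[ℝ] Eu n →L[ℝ] ℝ)) ∞
    (fun x => Bundle.TotalSpace.mk' (Eu n →L[ℝ] Eu n →L[ℝ] ℝ)
      (E := fun x : M => TangentSpace (𝓡 n) x →L[ℝ] TangentSpace (𝓡 n) x →L[ℝ] ℝ) x (inner x))

/-- The smooth charts of `M`. -/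
abbrev charts (n : ℕ) (M : Type*) [TopologicalSpace M] [ChartedSpace (Eu n) M] :
    Set (OpenPartialHomeomorph M (Eu n)) :=
  IsManifold.maximalAtlas (𝓡 n) ∞ M

/-- The Gram form of a `(0,2)`-tensor field in the chart `e`, at the point with coordinates `y`. -/
def gram (g : ∀ x : M, TangentSpace (𝓡 n) x →L[ℝ] TangentSpace (𝓡 n) x →L[ℝ] ℝ)
    (e : OpenPartialHomeomorph M (Eu n)) (y : Eu n) : Eu n →L[ℝ] Eu n →L[ℝ] ℝ :=
  ContinuousLinearMap.bilinearComp (E := Eu n) (F := Eu n) (E' := Eu n) (F' := Eu n)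
    (g (e.symm y)) (mfderiv (𝓡 n) (𝓡 n) e.symm y) (mfderiv (𝓡 n) (𝓡 n) e.symm y)

/-- The coordinates of a vector field in the chart `e`. -/
def fieldIn (V : ∀ x : M, TangentSpace (𝓡 n) x)
    (e : OpenPartialHomeomorph M (Eu n)) (y : Eu n) : Eu n :=
  mfderiv (𝓡 n) (𝓡 n) e (e.symm y) (V (e.symm y))

/-- The map `f` in the charts `e` of `M` and `e'` of `M'`. -/
def mapIn (f : M → M') (e : OpenPartialHomeomorph M (Eu n))
    (e' : OpenPartialHomeomorph M' (Eu m)) (y : Eu n) : Eu m :=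
  e' (f (e.symm y))

/-- The coordinates of a vector field `N` along the map `f : M → M'`, in the charts `e` of `M` and
`e'` of `M'`. -/
def alongIn (f : M → M') (N : ∀ p : M, TangentSpace (𝓡 m) (f p))
    (e : OpenPartialHomeomorph M (Eu n)) (e' : OpenPartialHomeomorph M' (Eu m)) (y : Eu n) :
    Eu m :=
  mfderiv (𝓡 m) (𝓡 m) e' (f (e.symm y)) (N (e.symm y))

/-- The semi-Riemannian manifold `(M, g)` has constant sectional curvature `c`: every nondegenerate
tangent plane has sectional curvature `c`. -/
def HasConstantSectionalCurvature [IsManifold (𝓡 n) ∞ M] (g : SemiRiemannianMetric n M)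
    (c : ℝ) : Prop :=
  ∀ e ∈ charts n M, ∀ y ∈ e.target, ∀ u v : Eu n,
    planeDet (gram g.inner e) y u v ≠ 0 → sectional (gram g.inner e) y u v = c

/-- `V` is a conformal vector field of `(M, g)` with conformal factor `σ`: both are smooth and
`L_V g = 2 σ g`. -/
structure IsConformalField [IsManifold (𝓡 n) ∞ M] (g : SemiRiemannianMetric n M)
    (V : ∀ x : M, TangentSpace (𝓡 n) x) (σ : M → ℝ) : Prop where
  contMDiff_field : ContMDiff (𝓡 n) (𝓡 n).tangent ∞
    (fun x => (⟨x, V x⟩ : TangentBundle (𝓡 n) M))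
  contMDiff_factor : ContMDiff (𝓡 n) 𝓘(ℝ, ℝ) ∞ σ
  lieDeriv_eq : ∀ e ∈ charts n M, ∀ y ∈ e.target, ∀ u w : Eu n,
    lieDerivMetric (gram g.inner e) (fieldIn V e) y u w
      = 2 * σ (e.symm y) * gram g.inner e y u w

/-- `ρ` is a scalar concircular field of the Riemannian manifold `(M, g)` with characteristic
function `φ`: both are smooth and `Hess ρ = φ g`. -/
structure IsScalarConcircularField [IsManifold (𝓡 n) ∞ M] (g : RiemannianMetric n M)
    (ρ φ : M → ℝ) : Prop where
  contMDiff_field : ContMDiff (𝓡 n) 𝓘(ℝ, ℝ) ∞ ρ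
  contMDiff_char : ContMDiff (𝓡 n) 𝓘(ℝ, ℝ) ∞ φ
  hessian_eq : ∀ e ∈ charts n M, ∀ y ∈ e.target, ∀ u v : Eu n,
    hessian (gram g.inner e) (fun z => ρ (e.symm z)) y u v
      = φ (e.symm y) * gram g.inner e y u v

/-- `ρ` is a special scalar concircular field of `(M, g)` with the constants `k` and `b`:
`Hess ρ = (-k ρ + b) g`. -/
def IsSpecialScalarConcircularField [IsManifold (𝓡 n) ∞ M] (g : RiemannianMetric n M)
    (ρ : M → ℝ) (k b : ℝ) : Prop :=
  IsScalarConcircularField g ρ (fun p => -k * ρ p + b)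

/-- `f` is an isometric immersion of `(M, g)` into `(M', g')`: it is smooth and `f^* g' = g`
(as `g` is positive definite, the differential of `f` is then injective). -/
structure IsIsometricImmersion [IsManifold (𝓡 n) ∞ M] [IsManifold (𝓡 m) ∞ M']
    (g : RiemannianMetric n M) (g' : SemiRiemannianMetric m M') (f : M → M') : Prop where
  contMDiff : ContMDiff (𝓡 n) (𝓡 m) ∞ f
  pullback_eq : ∀ (p : M) (u v : TangentSpace (𝓡 n) p),
    g'.inner (f p) (mfderiv (𝓡 n) (𝓡 m) f p u) (mfderiv (𝓡 n) (𝓡 m) f p v) = g.inner p u v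

/-- `N` is a smooth field of unit normal vectors along `f : M → M'`, of sign
`ε = g'(N,N) = ±1`. -/
structure IsUnitNormal [IsManifold (𝓡 m) ∞ M']
    (g' : SemiRiemannianMetric m M') (f : M → M')
    (N : ∀ p : M, TangentSpace (𝓡 m) (f p)) (ε : ℝ) : Prop where
  contMDiff : ContMDiff (𝓡 n) (𝓡 m).tangent ∞
    (fun p => (⟨f p, N p⟩ : TangentBundle (𝓡 m) M'))
  sign : ε = 1 ∨ ε = -1
  unit : ∀ p, g'.inner (f p) (N p) (N p) = ε
  normal : ∀ (p : M) (u : TangentSpace (𝓡 n) p),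
    g'.inner (f p) (N p) (mfderiv (𝓡 n) (𝓡 m) f p u) = 0

/-- The hypersurface `f : M → M'` with unit normal field `N` is totally umbilic: its second
fundamental form is, at each point, proportional to its first fundamental form `g`. -/
def IsTotallyUmbilic [IsManifold (𝓡 n) ∞ M] [IsManifold (𝓡 m) ∞ M']
    (g : RiemannianMetric n M) (g' : SemiRiemannianMetric m M') (f : M → M')
    (N : ∀ p : M, TangentSpace (𝓡 m) (f p)) : Prop :=
  ∃ μ : M → ℝ, ∀ e ∈ charts n M, ∀ e' ∈ charts m M', ∀ y ∈ e.target,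
    f (e.symm y) ∈ e'.source → ∀ u v : Eu n,
      secondForm (gram g'.inner e') (mapIn f e e') (alongIn f N e e') y u v
        = μ (e.symm y) * gram g.inner e y u v

/-- The mean curvature function `H = ε (1/n) tr A` of the hypersurface `f : M → M'` with unit normal
field `N` of sign `ε`, where `A` is the Weingarten operator. The trace does not depend on the
charts used to compute it. -/
def meanCurvature [IsManifold (𝓡 n) ∞ M] [IsManifold (𝓡 m) ∞ M']
    (g : RiemannianMetric n M) (g' : SemiRiemannianMetric m M') (f : M → M')
    (N : ∀ p : M, TangentSpace (𝓡 m) (f p)) (ε : ℝ) (p : M) : ℝ :=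
  let e := chartAt (Eu n) p
  let e' := chartAt (Eu m) (f p)
  ε * (1 / (n : ℝ)) * ∑ i : Fin n,
    weingarten (gram g.inner e) (gram g'.inner e') (mapIn f e e') (alongIn f N e e') (e p)
      (EuclideanSpace.single i 1) i

/-- The angle function `C = g'(V, N)`. -/
def angle [IsManifold (𝓡 m) ∞ M'] (g' : SemiRiemannianMetric m M') (f : M → M')
    (N : ∀ p : M, TangentSpace (𝓡 m) (f p)) (V : ∀ x : M', TangentSpace (𝓡 m) x) (p : M) : ℝ :=
  g'.inner (f p) (V (f p)) (N p)

/-- The derivative `N σ` of a function `σ` on `M'` in direction of the field `N` along `f`. -/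
def normalDeriv (f : M → M') (N : ∀ p : M, TangentSpace (𝓡 m) (f p)) (σ : M' → ℝ) (p : M) : ℝ :=
  mfderiv (𝓡 m) 𝓘(ℝ, ℝ) σ (f p) (N p)

end Manifolds

end SemiRiem

end

/-! Write the umbilic condition as `II = μ g`, so that `A = μ I` and `H = ε μ`. With `ε² = 1` the
two constants become `k = c + ε μ²` and `b = -(Nσ + μ σ)`. In constant curvature, commuting the
covariant derivatives of `N` gives no normal curvature term (Codazzi). Since `∇̄_u N = -μ df(u)`,
this leaves `dμ(u) df(v) = dμ(v) df(u)`, and `dμ = 0` because `n ≥ 2` (`fderiv_factor_eq_zero`).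

The rest rests on one auxiliary field along `f`, `Z = ∇̄_N V + μ V - σ N` (`closedField`).
Conformality of `V` makes its tangential part minus the gradient of `C` (`fderiv_angle`), and `⟨Z,
N⟩ = μ C`. A conformal field in constant curvature has an explicit second covariant derivative
(`IsConformalOn.inner_secondCovDeriv`), which yields `∇̄_u Z = (c C - b) df(u)`
(`covAlong_closedField`). Differentiating `dC(v) = -⟨Z, df(v)⟩` once more and using the Gauss
formula gives `Hess C = (-(c C - b) - ε μ² C) g`, which is the claim (`hessian_angle`).

Constancy of `b` comes from commuting the derivatives of `Z`: the terms in `dC` match the curvature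
term `R(u,v)Z`, leaving `db(u) df(v) = db(v) df(u)`, hence `db = 0` (`fderiv_potential_eq_zero`).

All this is done in coordinates on open sets of vector spaces. `isHypersurfaceOn` and
`isConformalOn` carry the manifold data into a pair of charts, and `exists_eq_const` turns vanishing
differentials into constants on the connected manifold. -/

noncomputable section

namespace SemiRiem

/-! ### Levi-Civita calculus in coordinates and along maps -/

section LocalTheory

set_option maxSynthPendingDepth 3

variable {E F : Type*} [NormedAddCommGroup E] [NormedSpace ℝ E]
  [NormedAddCommGroup F] [NormedSpace ℝ F]

/-- `G` is a smooth semi-Riemannian metric on the open set `Ω`. -/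
structure IsMetricOn (G : F → F →L[ℝ] F →L[ℝ] ℝ) (Ω : Set F) : Prop where
  isOpen : IsOpen Ω
  contDiffOn : ContDiffOn ℝ ∞ G Ω
  symm : ∀ y ∈ Ω, ∀ u v, G y u v = G y v u
  nondegenerate : ∀ y ∈ Ω, ∀ u, (∀ v, G y u v = 0) → u = 0

/-- The Christoffel symbols of the first kind as a continuous bilinear map. -/
def christoffelLowerCLM (G : F → F →L[ℝ] F →L[ℝ] ℝ) (y : F) : F →L[ℝ] F →L[ℝ] F →L[ℝ] ℝ :=
  (1 / 2 : ℝ) • (fderiv ℝ G y + (fderiv ℝ G y).flip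
    - ((ContinuousLinearMap.flipₗᵢ ℝ F F ℝ).toContinuousLinearEquiv.toContinuousLinearMap.comp
      (fderiv ℝ G y).flip))

/-- The Christoffel symbols of the second kind as a continuous bilinear map. -/
def christoffelCLM (G : F → F →L[ℝ] F →L[ℝ] ℝ) (y : F) : F →L[ℝ] F →L[ℝ] F :=
  ((ContinuousLinearMap.compL ℝ F (F →L[ℝ] ℝ) F) (G y).inverse).comp (christoffelLowerCLM G y)

lemma christoffelCLM_apply (G : F → F →L[ℝ] F →L[ℝ] ℝ) (y u v : F) :
    christoffelCLM G y u v = christoffel G y u v := rfl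

lemma christoffelLower_apply (G : F → F →L[ℝ] F →L[ℝ] ℝ) (y u v w : F) :
    christoffelLower G y u v w
      = (1 / 2) * (fderiv ℝ G y u v w + fderiv ℝ G y v u w - fderiv ℝ G y w u v) := rfl

lemma covAlong_eq (G : F → F →L[ℝ] F →L[ℝ] ℝ) (f N : E → F) (y u : E) :
    covAlong G f N y u
      = fderiv ℝ N y u + christoffelCLM G (f y) (fderiv ℝ f y u) (N y) := rfl

section Single

variable {G : F → F →L[ℝ] F →L[ℝ] ℝ} {Ω : Set F}

lemma IsMetricOn.contDiffAt (hG : IsMetricOn G Ω) {y : F} (hy : y ∈ Ω) : ContDiffAt ℝ ∞ G y :=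
  hG.contDiffOn.contDiffAt (hG.isOpen.mem_nhds hy)

lemma IsMetricOn.differentiableAt (hG : IsMetricOn G Ω) {y : F} (hy : y ∈ Ω) :
    DifferentiableAt ℝ G y :=
  (hG.contDiffAt hy).differentiableAt (by simp)

lemma IsMetricOn.fderiv_symm (hG : IsMetricOn G Ω) {y : F} (hy : y ∈ Ω) (w u v : F) :
    fderiv ℝ G y w u v = fderiv ℝ G y w v u := by
  have h1 : ∀ a b : F, fderiv ℝ (fun z => G z a b) y w = fderiv ℝ G y w a b := by
    intro a b
    have hd := hG.differentiableAt hy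
    have := ((hd.hasFDerivAt.clm_apply (hasFDerivAt_const a y)).clm_apply
      (hasFDerivAt_const b y)).fderiv
    simp [this]
  rw [← h1, ← h1]
  have : (fun z => G z u v) =ᶠ[nhds y] fun z => G z v u := by
    filter_upwards [hG.isOpen.mem_nhds hy] with z hz using hG.symm z hz u v
  rw [this.fderiv_eq]

variable [FiniteDimensional ℝ F]

/-- A nondegenerate form is injective into a dual of the same finite dimension. Hence `(G
y).inverse` is the true inverse and not the default value `0`. -/
lemma IsMetricOn.exists_equiv (hG : IsMetricOn G Ω) {y : F} (hy : y ∈ Ω) :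
    ∃ e : F ≃L[ℝ] (F →L[ℝ] ℝ), (e : F →L[ℝ] F →L[ℝ] ℝ) = G y := by
  have hinj : Function.Injective (G y : F →ₗ[ℝ] F →L[ℝ] ℝ) := by
    rw [← LinearMap.ker_eq_bot, LinearMap.ker_eq_bot']
    intro u hu
    refine hG.nondegenerate y hy u fun v => ?_
    have := congrArg (fun l : F →L[ℝ] ℝ => l v) hu
    simpa using this
  have hdim : Module.finrank ℝ F = Module.finrank ℝ (F →L[ℝ] ℝ) := by
    rw [← (LinearMap.toContinuousLinearMap (𝕜 := ℝ) (E := F) (F' := ℝ)).finrank_eq]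
    exact (Subspace.dual_finrank_eq (K := ℝ) (V := F)).symm
  refine ⟨(LinearMap.linearEquivOfInjective _ hinj hdim).toContinuousLinearEquiv, ?_⟩
  ext u v
  simp

lemma IsMetricOn.apply_inverse (hG : IsMetricOn G Ω) {y : F} (hy : y ∈ Ω) (l : F →L[ℝ] ℝ) :
    G y ((G y).inverse l) = l := by
  obtain ⟨e, he⟩ := hG.exists_equiv hy
  rw [← he, ContinuousLinearMap.inverse_equiv]
  simp

lemma IsMetricOn.inverse_apply (hG : IsMetricOn G Ω) {y : F} (hy : y ∈ Ω) (u : F) :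
    (G y).inverse (G y u) = u := by
  obtain ⟨e, he⟩ := hG.exists_equiv hy
  rw [← he, ContinuousLinearMap.inverse_equiv]
  simp

omit [FiniteDimensional ℝ F] in
lemma IsMetricOn.ext (hG : IsMetricOn G Ω) {y : F} (hy : y ∈ Ω) {u v : F}
    (h : ∀ w, G y u w = G y v w) : u = v :=
  sub_eq_zero.1 (hG.nondegenerate y hy _ fun w => by simp [h w])

lemma IsMetricOn.apply_christoffel (hG : IsMetricOn G Ω) {y : F} (hy : y ∈ Ω) (u v w : F) :
    G y (christoffelCLM G y u v) w
      = (1 / 2) * (fderiv ℝ G y u v w + fderiv ℝ G y v u w - fderiv ℝ G y w u v) := by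
  rw [christoffelCLM_apply, christoffel, hG.apply_inverse hy, christoffelLower_apply]

lemma IsMetricOn.christoffel_symm (hG : IsMetricOn G Ω) {y : F} (hy : y ∈ Ω) (u v : F) :
    christoffelCLM G y u v = christoffelCLM G y v u := by
  refine hG.ext hy fun w => ?_
  rw [hG.apply_christoffel hy, hG.apply_christoffel hy, hG.fderiv_symm hy w u v]
  ring

/-- The Levi-Civita connection is metric. -/
lemma IsMetricOn.fderiv_eq (hG : IsMetricOn G Ω) {y : F} (hy : y ∈ Ω) (w u v : F) :
    fderiv ℝ G y w u v
      = G y (christoffelCLM G y w u) v + G y u (christoffelCLM G y w v) := by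
  rw [hG.symm y hy u, hG.apply_christoffel hy, hG.apply_christoffel hy,
    hG.fderiv_symm hy w v u, hG.fderiv_symm hy u w v, hG.fderiv_symm hy v w u]
  ring

/-- Inversion of continuous linear maps is smooth at an isomorphism, so raising the index keeps
smoothness. -/
lemma IsMetricOn.contDiffOn_christoffel (hG : IsMetricOn G Ω) :
    ContDiffOn ℝ ∞ (christoffelCLM G) Ω := by
  intro y hy
  refine ContDiffAt.contDiffWithinAt ?_
  have h1 : ContDiffAt ℝ ∞ (fderiv ℝ G) y := (hG.contDiffAt hy).fderiv_right (by simp)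
  have h2 : ContDiffAt ℝ ∞ (fun z => (fderiv ℝ G z).flip) y :=
    ((ContinuousLinearMap.flipₗᵢ ℝ F F (F →L[ℝ] ℝ)).toContinuousLinearEquiv.contDiff.contDiffAt).comp
      y h1
  have h3 : ContDiffAt ℝ ∞ (fun z => (G z).inverse) y := by
    obtain ⟨e, he⟩ := hG.exists_equiv hy
    have := contDiffAt_map_inverse (𝕜 := ℝ) (n := ∞) e
    rw [he] at this
    exact this.comp y (hG.contDiffAt hy)
  have h4 : ContDiffAt ℝ ∞ (christoffelLowerCLM G) y := by
    unfold christoffelLowerCLM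
    exact ((h1.add h2).sub (contDiffAt_const.clm_comp h2)).const_smul (1 / 2 : ℝ)
  unfold christoffelCLM
  exact (contDiffAt_const.clm_apply h3).clm_comp h4

lemma IsMetricOn.contDiffAt_christoffel (hG : IsMetricOn G Ω) {y : F} (hy : y ∈ Ω) :
    ContDiffAt ℝ ∞ (christoffelCLM G) y :=
  hG.contDiffOn_christoffel.contDiffAt (hG.isOpen.mem_nhds hy)

lemma IsMetricOn.differentiableAt_christoffel (hG : IsMetricOn G Ω) {y : F} (hy : y ∈ Ω) :
    DifferentiableAt ℝ (christoffelCLM G) y :=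
  (hG.contDiffAt_christoffel hy).differentiableAt (by simp)

lemma fderiv_clm_apply₂ {A B D : Type*} [NormedAddCommGroup A] [NormedSpace ℝ A]
    [NormedAddCommGroup B] [NormedSpace ℝ B] [NormedAddCommGroup D] [NormedSpace ℝ D]
    {T : E → A →L[ℝ] B →L[ℝ] D} {a : E → A} {b : E → B} {y : E}
    (hT : DifferentiableAt ℝ T y) (ha : DifferentiableAt ℝ a y) (hb : DifferentiableAt ℝ b y)
    (u : E) :
    fderiv ℝ (fun z => T z (a z) (b z)) y u
      = fderiv ℝ T y u (a y) (b y) + T y (fderiv ℝ a y u) (b y) + T y (a y) (fderiv ℝ b y u) := by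
  have := ((hT.hasFDerivAt.clm_apply ha.hasFDerivAt).clm_apply hb.hasFDerivAt).fderiv
  rw [this]
  simp
  abel

lemma fderiv_clm_apply₁ {A B : Type*} [NormedAddCommGroup A] [NormedSpace ℝ A]
    [NormedAddCommGroup B] [NormedSpace ℝ B]
    {T : E → A →L[ℝ] B} {a : E → A} {y : E}
    (hT : DifferentiableAt ℝ T y) (ha : DifferentiableAt ℝ a y) (u : E) :
    fderiv ℝ (fun z => T z (a z)) y u = fderiv ℝ T y u (a y) + T y (fderiv ℝ a y u) := by
  rw [(hT.hasFDerivAt.clm_apply ha.hasFDerivAt).fderiv]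
  simp
  abel

/-- Differentiating the bilinear-map-valued Christoffel symbol makes the curvature visibly
multilinear, so that later identities reduce to `simp` and `ring`. -/
lemma riemann_eq (hG : IsMetricOn G Ω) {y : F} (hy : y ∈ Ω) (u v w : F) :
    riemann G y u v w
      = fderiv ℝ (christoffelCLM G) y u v w - fderiv ℝ (christoffelCLM G) y v u w
        + christoffelCLM G y u (christoffelCLM G y v w)
        - christoffelCLM G y v (christoffelCLM G y u w) := by
  have h : ∀ a b d : F, fderiv ℝ (fun z => christoffel G z a b) y d
      = fderiv ℝ (christoffelCLM G) y d a b := by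
    intro a b d
    have := fderiv_clm_apply₂ (hG.differentiableAt_christoffel hy)
      (differentiableAt_const a) (differentiableAt_const b) d
    simp only [fderiv_fun_const, Pi.zero_apply, zero_apply, map_zero, add_zero] at this
    exact this
  rw [riemann, h, h]
  rfl

/-- Compatibility of the connection along a map with the metric. -/
lemma IsMetricOn.fderiv_inner (hG : IsMetricOn G Ω) {f S T : E → F} {y : E} (hy : f y ∈ Ω)
    (hf : DifferentiableAt ℝ f y) (hS : DifferentiableAt ℝ S y) (hT : DifferentiableAt ℝ T y)
    (u : E) :
    fderiv ℝ (fun z => G (f z) (S z) (T z)) y u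
      = G (f y) (covAlong G f S y u) (T y) + G (f y) (S y) (covAlong G f T y u) := by
  have hd := hG.differentiableAt hy
  rw [fderiv_clm_apply₂ (T := fun z => G (f z)) (hd.comp y hf) hS hT]
  have : fderiv ℝ (fun z => G (f z)) y u = fderiv ℝ G (f y) (fderiv ℝ f y u) := by
    have := fderiv_comp y hd hf
    simp only [Function.comp_def] at this
    rw [this]; rfl
  rw [this, hG.fderiv_eq hy, covAlong_eq, covAlong_eq]
  simp only [map_add, add_apply]
  ring

lemma fderiv_christoffel_comp (hG : IsMetricOn G Ω) {f : E → F} {y : E} (hy : f y ∈ Ω)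
    (hf : DifferentiableAt ℝ f y) (u : E) :
    fderiv ℝ (fun z => christoffelCLM G (f z)) y u
      = fderiv ℝ (christoffelCLM G) (f y) (fderiv ℝ f y u) := by
  have := fderiv_comp y (hG.differentiableAt_christoffel hy) hf
  simp only [Function.comp_def] at this
  rw [this]; rfl

lemma fderiv_fderiv_apply {A : Type*} [NormedAddCommGroup A] [NormedSpace ℝ A] {S : E → A} {y : E}
    (hS : ContDiffAt ℝ ∞ S y) (u v : E) :
    fderiv ℝ (fun z => fderiv ℝ S z v) y u = fderiv ℝ (fderiv ℝ S) y u v := by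
  have h : DifferentiableAt ℝ (fderiv ℝ S) y :=
    (hS.fderiv_right (m := ∞) (by simp)).differentiableAt (by simp)
  have := fderiv_clm_apply₁ h (differentiableAt_const v) u
  simpa using this

lemma fderiv_fderiv_symm {A : Type*} [NormedAddCommGroup A] [NormedSpace ℝ A] {S : E → A} {y : E}
    (hS : ContDiffAt ℝ ∞ S y) (u v : E) :
    fderiv ℝ (fderiv ℝ S) y u v = fderiv ℝ (fderiv ℝ S) y v u :=
  (hS.isSymmSndFDerivAt (by
    simpa using (WithTop.coe_le_coe.2 le_top : ((2 : ℕ∞) : ℕ∞ω) ≤ ∞))).eq u v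

lemma differentiableAt_fderiv_apply {A : Type*} [NormedAddCommGroup A] [NormedSpace ℝ A]
    {S : E → A} {y : E} (hS : ContDiffAt ℝ ∞ S y) (v : E) :
    DifferentiableAt ℝ (fun z => fderiv ℝ S z v) y :=
  ((hS.fderiv_right (m := ∞) (by simp)).differentiableAt (by simp)).clm_apply
    (differentiableAt_const v)

/-- The Levi-Civita connection along a map is torsion free. -/
lemma IsMetricOn.covAlong_fderiv_symm (hG : IsMetricOn G Ω) {f : E → F} {y : E} (hy : f y ∈ Ω)
    (hf : ContDiffAt ℝ ∞ f y) (u v : E) :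
    covAlong G f (fun z => fderiv ℝ f z v) y u = covAlong G f (fun z => fderiv ℝ f z u) y v := by
  rw [covAlong_eq, covAlong_eq, fderiv_fderiv_apply hf, fderiv_fderiv_apply hf,
    fderiv_fderiv_symm hf, hG.christoffel_symm hy]

lemma contDiffAt_covAlong (hG : IsMetricOn G Ω) {f S : E → F} {y : E} (hy : f y ∈ Ω)
    (hf : ContDiffAt ℝ ∞ f y) (hS : ContDiffAt ℝ ∞ S y) (v : E) :
    ContDiffAt ℝ ∞ (fun z => covAlong G f S z v) y := by
  unfold covAlong
  refine ((hS.fderiv_right (m := ∞) (by simp)).clm_apply contDiffAt_const).add ?_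
  have h1 : ContDiffAt ℝ ∞ (fun z => christoffelCLM G (f z)) y :=
    (hG.contDiffAt_christoffel hy).comp y hf
  exact (h1.clm_apply ((hf.fderiv_right (m := ∞) (by simp)).clm_apply contDiffAt_const)).clm_apply hS

/-- The curvature as the commutator of covariant derivatives along a map. -/
lemma covAlong_covAlong_sub (hG : IsMetricOn G Ω) {f S : E → F} {y : E} (hy : f y ∈ Ω)
    (hf : ContDiffAt ℝ ∞ f y) (hS : ContDiffAt ℝ ∞ S y) (u v : E) :
    covAlong G f (fun z => covAlong G f S z v) y u - covAlong G f (fun z => covAlong G f S z u) y v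
      = riemann G (f y) (fderiv ℝ f y u) (fderiv ℝ f y v) (S y) := by
  have hfd : DifferentiableAt ℝ f y := hf.differentiableAt (by simp)
  have hSd : DifferentiableAt ℝ S y := hS.differentiableAt (by simp)
  have hΓ : DifferentiableAt ℝ (fun z => christoffelCLM G (f z)) y :=
    (hG.differentiableAt_christoffel hy).comp y hfd
  have key : ∀ a b : E, covAlong G f (fun z => covAlong G f S z b) y a
      = fderiv ℝ (fderiv ℝ S) y a b
        + (fderiv ℝ (christoffelCLM G) (f y) (fderiv ℝ f y a) (fderiv ℝ f y b) (S y)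
          + christoffelCLM G (f y) (fderiv ℝ (fderiv ℝ f) y a b) (S y)
          + christoffelCLM G (f y) (fderiv ℝ f y b) (fderiv ℝ S y a))
        + christoffelCLM G (f y) (fderiv ℝ f y a)
            (fderiv ℝ S y b + christoffelCLM G (f y) (fderiv ℝ f y b) (S y)) := by
    intro a b
    have h1 := fderiv_clm_apply₂ hΓ (differentiableAt_fderiv_apply hf b) hSd a
    have h2 : DifferentiableAt ℝ
        (fun z => christoffelCLM G (f z) (fderiv ℝ f z b) (S z)) y :=
      (hΓ.clm_apply (differentiableAt_fderiv_apply hf b)).clm_apply hSd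
    rw [covAlong_eq G f (fun z => covAlong G f S z b)]
    simp only [covAlong_eq G f S]
    rw [fderiv_fun_add (differentiableAt_fderiv_apply hS b) h2, add_apply, h1,
      fderiv_fderiv_apply hf, fderiv_fderiv_apply hS, fderiv_christoffel_comp hG hy hfd]
  -- The second derivatives of `S` and `f`, and the two mixed terms in `fderiv ℝ S`, are symmetric
  -- under exchange of `u` and `v`. Only the curvature survives.
  rw [key, key, riemann_eq hG hy, fderiv_fderiv_symm hS v u, fderiv_fderiv_symm hf v u]
  simp only [map_add]
  abel

end Single

end LocalTheory

/-! ### Curvature identities and constant sectional curvature -/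

section Curvature

set_option maxSynthPendingDepth 3

variable {F : Type*} [NormedAddCommGroup F] [NormedSpace ℝ F]

omit [NormedSpace ℝ F] in
/-- An algebraic curvature tensor with vanishing sectional curvatures vanishes. -/
lemma curvatureTensor_eq_zero {T : F → F → F → F → ℝ}
    (add₁ : ∀ u u' v w x, T (u + u') v w x = T u v w x + T u' v w x)
    (add₂ : ∀ u v v' w x, T u (v + v') w x = T u v w x + T u v' w x)
    (add₃ : ∀ u v w w' x, T u v (w + w') x = T u v w x + T u v w' x)
    (add₄ : ∀ u v w x x', T u v w (x + x') = T u v w x + T u v w x')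
    (antisymm₁ : ∀ u v w x, T u v w x = -T v u w x)
    (antisymm₂ : ∀ u v w x, T u v w x = -T u v x w)
    (bianchi : ∀ u v w x, T u v w x + T v w u x + T w u v x = 0)
    (h : ∀ u v, T u v v u = 0) (u v w x : F) : T u v w x = 0 := by
  -- Pair symmetry is a linear consequence of four Bianchi identities and the two antisymmetries.
  have pair : ∀ u v w x, T u v w x = T w x u v := by
    intro u v w x
    linarith [bianchi u v w x, bianchi v w x u, bianchi w x u v, bianchi x u v w,
      antisymm₁ u v w x, antisymm₁ v w u x, antisymm₁ w u v x, antisymm₁ x u v w,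
      antisymm₂ u v w x, antisymm₂ v w u x, antisymm₂ w u v x, antisymm₂ v w x u,
      antisymm₂ w x v u, antisymm₂ x v w u, antisymm₂ w x u v, antisymm₂ x u w v,
      antisymm₂ u w x v, antisymm₂ x u v w, antisymm₂ u v x w, antisymm₂ v x u w,
      antisymm₁ x v w u, antisymm₁ u w x v, antisymm₁ v x u w, antisymm₁ w u x v,
      antisymm₁ v x w u]
  -- Polarise `h` in its inner argument; the two mixed terms agree by pair symmetry. Polarising the
  -- result in the outer argument then gives `h₃`.
  have h₂ : ∀ u v w, T u v w u = 0 := by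
    intro u v w
    have e := h u (v + w)
    rw [add₂, add₃, add₃, h, h] at e
    linarith [pair u w v u, antisymm₁ v u u w, antisymm₂ u v u w]
  have h₃ : ∀ u v w x, T u v w x = -T u w v x := by
    intro u v w x
    have e := h₂ (u + x) v w
    rw [add₁, add₄, add₄, h₂, h₂] at e
    linarith [pair x v w u, antisymm₁ w u x v, antisymm₂ u w x v]
  -- Antisymmetry in the first three slots makes `T` invariant under their cyclic permutations, so
  -- Bianchi reads `3 T = 0`.
  linarith [bianchi u v w x, h₃ u v w x, antisymm₁ v w u x, h₃ w v u x, antisymm₁ w u v x,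
    antisymm₁ u w v x]

variable {G : F → F →L[ℝ] F →L[ℝ] ℝ} {Ω : Set F} [FiniteDimensional ℝ F]

lemma IsMetricOn.riemann_antisymm (hG : IsMetricOn G Ω) {y : F} (hy : y ∈ Ω) (u v w : F) :
    riemann G y u v w = -riemann G y v u w := by
  rw [riemann_eq hG hy, riemann_eq hG hy]
  abel

lemma IsMetricOn.fderiv_christoffel_symm (hG : IsMetricOn G Ω) {y : F} (hy : y ∈ Ω) (u v w : F) :
    fderiv ℝ (christoffelCLM G) y u v w = fderiv ℝ (christoffelCLM G) y u w v := by
  have h : ∀ a b : F, fderiv ℝ (fun z => christoffelCLM G z a b) y u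
      = fderiv ℝ (christoffelCLM G) y u a b := by
    intro a b
    have := fderiv_clm_apply₂ (hG.differentiableAt_christoffel hy)
      (differentiableAt_const a) (differentiableAt_const b) u
    simpa using this
  rw [← h, ← h]
  have : (fun z => christoffelCLM G z v w) =ᶠ[nhds y] fun z => christoffelCLM G z w v := by
    filter_upwards [hG.isOpen.mem_nhds hy] with z hz using hG.christoffel_symm hz v w
  rw [this.fderiv_eq]

lemma IsMetricOn.riemann_bianchi (hG : IsMetricOn G Ω) {y : F} (hy : y ∈ Ω) (u v w : F) :
    riemann G y u v w + riemann G y v w u + riemann G y w u v = 0 := by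
  rw [riemann_eq hG hy, riemann_eq hG hy, riemann_eq hG hy, hG.christoffel_symm hy v w,
    hG.christoffel_symm hy u w, hG.christoffel_symm hy u v,
    hG.fderiv_christoffel_symm hy u v w, hG.fderiv_christoffel_symm hy v w u,
    hG.fderiv_christoffel_symm hy w u v]
  abel

/-- The second derivative of `z ↦ G z w x` is symmetric. Expanding it by metric compatibility, with
`w` and `x` constant fields, the products of first covariant derivatives are symmetric too, so the
commutators must cancel each other. -/
lemma IsMetricOn.inner_riemann_antisymm (hG : IsMetricOn G Ω) {y : F} (hy : y ∈ Ω)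
    (u v w x : F) : G y (riemann G y u v w) x = -G y (riemann G y u v x) w := by
  have hid : ContDiffAt ℝ ∞ (fun z : F => z) y := contDiffAt_id
  have hc : ∀ (a z : F), ContDiffAt ℝ ∞ (fun _ : F => a) z := fun a z => contDiffAt_const
  have second : ∀ a b : F, fderiv ℝ (fderiv ℝ (fun z => G z w x)) y a b
      = G y (covAlong G (fun z => z) (fun z => covAlong G (fun z => z) (fun _ => w) z b) y a) x
        + G y (covAlong G (fun z => z) (fun _ => w) y b) (covAlong G (fun z => z) (fun _ => x) y a)
        + (G y (covAlong G (fun z => z) (fun _ => w) y a) (covAlong G (fun z => z) (fun _ => x) y b)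
        + G y w (covAlong G (fun z => z) (fun z => covAlong G (fun z => z) (fun _ => x) z b) y a)) := by
    intro a b
    have hs : ContDiffAt ℝ ∞ (fun z => G z w x) y :=
      ((hG.contDiffAt hy).clm_apply contDiffAt_const).clm_apply contDiffAt_const
    rw [← fderiv_fderiv_apply hs]
    have hev : (fun z => fderiv ℝ (fun z => G z w x) z b) =ᶠ[nhds y]
        fun z => G z (covAlong G (fun z => z) (fun _ => w) z b) x
          + G z w (covAlong G (fun z => z) (fun _ => x) z b) := by
      filter_upwards [hG.isOpen.mem_nhds hy] with z hz
      exact hG.fderiv_inner (f := fun z => z) (S := fun _ => w) (T := fun _ => x) hz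
        differentiableAt_id (differentiableAt_const w) (differentiableAt_const x) b
    have hw := (contDiffAt_covAlong hG (f := fun z => z) hy hid (hc w y) b).differentiableAt
      (by simp)
    have hx := (contDiffAt_covAlong hG (f := fun z => z) hy hid (hc x y) b).differentiableAt
      (by simp)
    have hGd := hG.differentiableAt hy
    rw [hev.fderiv_eq, fderiv_fun_add ((hGd.clm_apply hw).clm_apply (differentiableAt_const x))
      ((hGd.clm_apply (differentiableAt_const w)).clm_apply hx), add_apply,
      hG.fderiv_inner (f := fun z => z) hy differentiableAt_id hw (differentiableAt_const x),
      hG.fderiv_inner (f := fun z => z) hy differentiableAt_id (differentiableAt_const w) hx]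
  have hs : ContDiffAt ℝ ∞ (fun z => G z w x) y :=
    ((hG.contDiffAt hy).clm_apply contDiffAt_const).clm_apply contDiffAt_const
  have hsymm := fderiv_fderiv_symm hs u v
  rw [second, second] at hsymm
  have rw₁ := covAlong_covAlong_sub hG (f := fun z => z) hy hid (hc w y) u v
  have rx₁ := covAlong_covAlong_sub hG (f := fun z => z) hy hid (hc x y) u v
  simp only [fderiv_fun_id, ContinuousLinearMap.id_apply] at rw₁ rx₁
  rw [← rw₁, ← rx₁, hG.symm y hy _ w]
  simp only [map_sub, sub_apply]
  linarith

/-- The curvature tensor at a point where all nondegenerate planes have curvature `c`. -/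
lemma IsMetricOn.riemann_eq_of_sectional (hG : IsMetricOn G Ω) {y : F} (hy : y ∈ Ω) {c : ℝ}
    (hc : ∀ u v, planeDet G y u v ≠ 0 → sectional G y u v = c) {a b : F}
    (hab : planeDet G y a b ≠ 0) (u v w : F) :
    riemann G y u v w = c • (G y v w • u - G y u w • v) := by
  -- `T` is the defect from the constant curvature tensor. It has the same symmetries, so it is
  -- enough to kill `T u v v u`, including on degenerate planes where the hypothesis is silent.
  let T : F → F → F → F → ℝ := fun u v w x =>
    G y (riemann G y u v w) x - c * (G y v w * G y u x - G y u w * G y v x)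
  have hT : ∀ u v w x, T u v w x
      = G y (riemann G y u v w) x - c * (G y v w * G y u x - G y u w * G y v x) :=
    fun _ _ _ _ => rfl
  have hzero : ∀ u v, T u v v u = 0 := by
    intro u v
    -- The determinant of the plane moved along `(u + t a, v + t b)`. Its coefficient of `t⁴` is
    -- `planeDet G y a b ≠ 0`, so nondegenerate planes are dense on this line and continuity reaches
    -- `t = 0`.
    let P : Polynomial ℝ :=
      (.C (G y u u) + .C (2 * G y u a) * .X + .C (G y a a) * .X ^ 2)
        * (.C (G y v v) + .C (2 * G y v b) * .X + .C (G y b b) * .X ^ 2)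
      - (.C (G y u v) + .C (G y u b + G y a v) * .X + .C (G y a b) * .X ^ 2) ^ 2
    have hP : ∀ t : ℝ, P.eval t = planeDet G y (u + t • a) (v + t • b) := by
      intro t
      simp only [P, planeDet, map_add, map_smul, add_apply, smul_apply,
        smul_eq_mul, hG.symm y hy a u, hG.symm y hy b v]
      simp
      ring
    have hP0 : P ≠ 0 := by
      intro h0
      refine hab ?_
      have e : ∀ t : ℝ, planeDet G y (u + t • a) (v + t • b) = 0 := by
        intro t
        rw [← hP, h0, Polynomial.eval_zero]
      have e0 := e 0
      have e1 := e 1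
      have e2 := e 2
      have e3 := e (-1)
      have e4 := e (-2)
      simp only [planeDet, map_add, map_smul, add_apply, smul_apply,
        smul_eq_mul, hG.symm y hy a u, hG.symm y hy b v] at e0 e1 e2 e3 e4 ⊢
      -- The fourth central difference at `-2, …, 2`, divided by `4!`, extracts the leading
      -- coefficient of a quartic.
      linear_combination (1 / 24) * (e2 - 4 * e1 + 6 * e0 - 4 * e3 + e4)
    have hdense : Dense {t : ℝ | ¬ P.IsRoot t} := by
      have := (Polynomial.finite_setOfPred_isRoot hP0).countable.dense_compl ℝ
      exact this
    have hcont : Continuous fun t : ℝ =>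
        T (u + t • a) (v + t • b) (v + t • b) (u + t • a) := by
      simp only [hT, riemann_eq hG hy]
      fun_prop
    have hq := hcont.ext_on hdense (continuous_const (y := (0 : ℝ))) (by
      intro t ht
      have hne : planeDet G y (u + t • a) (v + t • b) ≠ 0 := by
        rw [← hP]; exact ht
      have := hc _ _ hne
      rw [sectional, div_eq_iff hne] at this
      simp only [hT, this, planeDet, hG.symm y hy (v + t • b) (u + t • a)]
      ring)
    have := congrFun hq 0
    simpa using this
  refine hG.ext hy fun x => ?_
  have key := curvatureTensor_eq_zero (T := T) ?_ ?_ ?_ ?_ ?_ ?_ ?_ hzero u v w x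
  · rw [hT] at key
    simp only [map_smul, map_sub, sub_apply, smul_apply, smul_eq_mul]
    linarith
  · intro u u' v w x
    simp only [hT, riemann_eq hG hy, map_add, map_sub, add_apply, sub_apply]
    ring
  · intro u u' v w x
    simp only [hT, riemann_eq hG hy, map_add, map_sub, add_apply, sub_apply]
    ring
  · intro u u' v w x
    simp only [hT, riemann_eq hG hy, map_add, map_sub, add_apply, sub_apply]
    ring
  · intro u u' v w x
    simp only [hT, map_add]
    ring
  · intro u v w x
    simp only [hT]
    rw [hG.riemann_antisymm hy u v, map_neg, neg_apply]
    ring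
  · intro u v w x
    simp only [hT]
    rw [hG.inner_riemann_antisymm hy u v w x]
    ring
  · intro u v w x
    have := congrArg (fun z => G y z x) (hG.riemann_bianchi hy u v w)
    simp only [map_add, add_apply, map_zero, zero_apply] at this
    simp only [hT]
    rw [hG.symm y hy w u, hG.symm y hy v u, hG.symm y hy w v]
    linarith

end Curvature

/-! ### Second covariant derivatives and conformal fields -/

section Hypersurface

set_option maxSynthPendingDepth 3

variable {E F : Type*} [NormedAddCommGroup E] [NormedSpace ℝ E]
  [NormedAddCommGroup F] [NormedSpace ℝ F]
  {Gbar : F → F →L[ℝ] F →L[ℝ] ℝ} {Ω : Set F}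

lemma covAlong_fun_add {f S T : E → F} {y : E} (hS : DifferentiableAt ℝ S y)
    (hT : DifferentiableAt ℝ T y) (u : E) :
    covAlong Gbar f (fun z => S z + T z) y u = covAlong Gbar f S y u + covAlong Gbar f T y u := by
  simp only [covAlong_eq, fderiv_fun_add hS hT, add_apply, map_add]
  abel

lemma covAlong_fun_smul {f S : E → F} {r : E → ℝ} {y : E} (hr : DifferentiableAt ℝ r y)
    (hS : DifferentiableAt ℝ S y) (u : E) :
    covAlong Gbar f (fun z => r z • S z) y u
      = fderiv ℝ r y u • S y + r y • covAlong Gbar f S y u := by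
  simp only [covAlong_eq, fderiv_fun_smul hr hS, add_apply, smul_apply, map_smul, smul_add,
    ContinuousLinearMap.smulRight_apply]
  abel

lemma covAlong_congr {f S T : E → F} {y : E} (h : S =ᶠ[nhds y] T) (u : E) :
    covAlong Gbar f S y u = covAlong Gbar f T y u := by
  simp only [covAlong_eq, h.fderiv_eq, h.eq_of_nhds]

/-- The endomorphism `w ↦ ∇_w V`. -/
def covDeriv (Gbar : F → F →L[ℝ] F →L[ℝ] ℝ) (V : F → F) (y : F) : F →L[ℝ] F :=
  fderiv ℝ V y + (christoffelCLM Gbar y).flip (V y)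

lemma covDeriv_apply (V : F → F) (y w : F) :
    covDeriv Gbar V y w = fderiv ℝ V y w + christoffelCLM Gbar y w (V y) := rfl

lemma covAlong_id (V : F → F) (y w : F) :
    covAlong Gbar (fun z => z) V y w = covDeriv Gbar V y w := by
  simp [covAlong_eq, covDeriv_apply]

/-- The second covariant derivative `∇²V(a, w) = ∇_a ∇_w V - ∇_{∇_a w} V`. -/
def secondCovDeriv (Gbar : F → F →L[ℝ] F →L[ℝ] ℝ) (V : F → F) (y a w : F) : F :=
  covAlong Gbar (fun z => z) (fun z => covDeriv Gbar V z w) y a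
    - covDeriv Gbar V y (christoffelCLM Gbar y a w)

/-- `V` is a conformal field with factor `σ` of the metric `Gbar` on `Ω`. -/
structure IsConformalOn (Gbar : F → F →L[ℝ] F →L[ℝ] ℝ) (V : F → F) (σ : F → ℝ) (Ω : Set F) :
    Prop where
  contDiffOn_field : ContDiffOn ℝ ∞ V Ω
  contDiffOn_factor : ContDiffOn ℝ ∞ σ Ω
  lieDeriv_eq : ∀ y ∈ Ω, ∀ u w, lieDerivMetric Gbar V y u w = 2 * σ y * Gbar y u w

section Conformal

variable [FiniteDimensional ℝ F] {V : F → F} {σ : F → ℝ}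

lemma contDiffAt_covDeriv (hG : IsMetricOn Gbar Ω) {y : F} (hy : y ∈ Ω)
    (hV : ContDiffAt ℝ ∞ V y) : ContDiffAt ℝ ∞ (covDeriv Gbar V) y := by
  have h : ContDiffAt ℝ ∞ (fun z => (christoffelCLM Gbar z).flip) y :=
    ((ContinuousLinearMap.flipₗᵢ ℝ F F F).toContinuousLinearEquiv.contDiff.contDiffAt).comp
      y (hG.contDiffAt_christoffel hy)
  exact (hV.fderiv_right (m := ∞) (by simp)).add (h.clm_apply hV)

/-- The Ricci identity: as the connection is torsion free, the two correction terms `∇_{∇_a w} V`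
and `∇_{∇_w a} V` cancel for constant `a`, `w`. -/
lemma secondCovDeriv_sub (hG : IsMetricOn Gbar Ω) {y : F} (hy : y ∈ Ω)
    (hV : ContDiffAt ℝ ∞ V y) (a w : F) :
    secondCovDeriv Gbar V y a w - secondCovDeriv Gbar V y w a = riemann Gbar y a w (V y) := by
  have := covAlong_covAlong_sub hG (f := fun z => z) hy contDiffAt_id hV a w
  simp only [fderiv_fun_id, ContinuousLinearMap.id_apply, covAlong_id] at this
  rw [← this, secondCovDeriv, secondCovDeriv, hG.christoffel_symm hy w a]
  simp only [covAlong_id]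
  abel

/-- The derivative of `∇_N V` along a map. -/
lemma covAlong_covDeriv (hG : IsMetricOn Gbar Ω) {f N : E → F} {y : E} (hy : f y ∈ Ω)
    (hf : DifferentiableAt ℝ f y) (hN : DifferentiableAt ℝ N y)
    (hV : ContDiffAt ℝ ∞ V (f y)) (u : E) :
    covAlong Gbar f (fun z => covDeriv Gbar V (f z) (N z)) y u
      = secondCovDeriv Gbar V (f y) (fderiv ℝ f y u) (N y)
        + covDeriv Gbar V (f y) (covAlong Gbar f N y u) := by
  have hd : DifferentiableAt ℝ (covDeriv Gbar V) (f y) :=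
    (contDiffAt_covDeriv hG hy hV).differentiableAt (by simp)
  have h1 : fderiv ℝ (fun z => covDeriv Gbar V (f z)) y u
      = fderiv ℝ (covDeriv Gbar V) (f y) (fderiv ℝ f y u) := by
    have := fderiv_comp y hd hf
    simp only [Function.comp_def] at this
    rw [this]; rfl
  have h2 := fderiv_clm_apply₁ hd (differentiableAt_const (N y)) (fderiv ℝ f y u)
  simp only [fderiv_fun_const, Pi.zero_apply, zero_apply, map_zero, add_zero] at h2
  have hcomp : DifferentiableAt ℝ (fun z => covDeriv Gbar V (f z)) y := hd.comp y hf
  rw [covAlong_eq, fderiv_clm_apply₁ hcomp hN, h1,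
    secondCovDeriv, covAlong_eq Gbar (fun z => z), h2, covAlong_eq]
  simp only [fderiv_fun_id, ContinuousLinearMap.id_apply, map_add]
  abel

omit [FiniteDimensional ℝ F] in
lemma covAlong_comp {f : E → F} {y : E}
    (hf : DifferentiableAt ℝ f y) (hV : DifferentiableAt ℝ V (f y)) (u : E) :
    covAlong Gbar f (fun z => V (f z)) y u = covDeriv Gbar V (f y) (fderiv ℝ f y u) := by
  have := fderiv_comp y hV hf
  simp only [Function.comp_def] at this
  rw [covAlong_eq, this]
  rfl

/-- For a metric torsion-free connection the Lie derivative of the metric is twice the symmetric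
part of `∇V`. -/
lemma IsConformalOn.inner_covDeriv (hG : IsMetricOn Gbar Ω) (hV : IsConformalOn Gbar V σ Ω)
    {y : F} (hy : y ∈ Ω) (u w : F) :
    Gbar y (covDeriv Gbar V y u) w + Gbar y u (covDeriv Gbar V y w)
      = 2 * σ y * Gbar y u w := by
  rw [← hV.lieDeriv_eq y hy, lieDerivMetric, hG.fderiv_eq hy, covDeriv_apply, covDeriv_apply,
    hG.christoffel_symm hy u, hG.christoffel_symm hy w]
  simp only [map_add, add_apply]
  ring

omit [FiniteDimensional ℝ F] in
lemma IsConformalOn.contDiffAt_field (hG : IsMetricOn Gbar Ω) (hV : IsConformalOn Gbar V σ Ω)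
    {y : F} (hy : y ∈ Ω) : ContDiffAt ℝ ∞ V y :=
  hV.contDiffOn_field.contDiffAt (hG.isOpen.mem_nhds hy)

omit [FiniteDimensional ℝ F] in
lemma IsConformalOn.contDiffAt_factor (hG : IsMetricOn Gbar Ω) (hV : IsConformalOn Gbar V σ Ω)
    {y : F} (hy : y ∈ Ω) : ContDiffAt ℝ ∞ σ y :=
  hV.contDiffOn_factor.contDiffAt (hG.isOpen.mem_nhds hy)

/-- The covariant derivative of `IsConformalOn.inner_covDeriv`. The Christoffel terms are absorbed
by that same identity, applied in `e1` and `e2`. -/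
lemma IsConformalOn.inner_secondCovDeriv_add (hG : IsMetricOn Gbar Ω)
    (hV : IsConformalOn Gbar V σ Ω) {y : F} (hy : y ∈ Ω) (a w v : F) :
    Gbar y (secondCovDeriv Gbar V y a w) v + Gbar y (secondCovDeriv Gbar V y a v) w
      = 2 * fderiv ℝ σ y a * Gbar y w v := by
  have hd : DifferentiableAt ℝ (covDeriv Gbar V) y :=
    (contDiffAt_covDeriv hG hy (hV.contDiffAt_field hG hy)).differentiableAt (by simp)
  have hGd := hG.differentiableAt hy
  have hσ : DifferentiableAt ℝ σ y := (hV.contDiffAt_factor hG hy).differentiableAt (by simp)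
  have hw := hd.clm_apply (differentiableAt_const w)
  have hv := hd.clm_apply (differentiableAt_const v)
  have hev : (fun z => Gbar z (covDeriv Gbar V z w) v + Gbar z w (covDeriv Gbar V z v))
      =ᶠ[nhds y] fun z => (2 * σ z) * Gbar z w v := by
    filter_upwards [hG.isOpen.mem_nhds hy] with z hz using hV.inner_covDeriv hG hz w v
  have e := congrArg (fun l : F →L[ℝ] ℝ => l a) hev.fderiv_eq
  have hwv : DifferentiableAt ℝ (fun z => Gbar z w v) y :=
    (hGd.clm_apply (differentiableAt_const w)).clm_apply (differentiableAt_const v)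
  rw [fderiv_fun_add ((hGd.clm_apply hw).clm_apply (differentiableAt_const v))
      ((hGd.clm_apply (differentiableAt_const w)).clm_apply hv), add_apply,
    fderiv_fun_mul (hσ.const_mul 2) hwv, fderiv_const_mul hσ,
    add_apply, smul_apply, smul_apply, smul_apply,
    hG.fderiv_inner (f := fun z => z) hy differentiableAt_id hw (differentiableAt_const v),
    hG.fderiv_inner (f := fun z => z) hy differentiableAt_id (differentiableAt_const w) hv,
    hG.fderiv_inner (f := fun z => z) hy differentiableAt_id (differentiableAt_const w)
      (differentiableAt_const v)] at e
  have hconst : ∀ x : F, covAlong Gbar (fun z => z) (fun _ => x) y a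
      = christoffelCLM Gbar y a x := by
    intro x
    simp [covAlong_eq]
  simp only [hconst, smul_eq_mul] at e
  have e1 := hV.inner_covDeriv hG hy (christoffelCLM Gbar y a w) v
  have e2 := hV.inner_covDeriv hG hy w (christoffelCLM Gbar y a v)
  rw [hG.symm y hy (secondCovDeriv Gbar V y a v) w, secondCovDeriv, secondCovDeriv]
  simp only [map_sub, sub_apply]
  linarith

/-- The second covariant derivative of a conformal field in constant curvature `c`. -/
lemma IsConformalOn.inner_secondCovDeriv (hG : IsMetricOn Gbar Ω)
    (hV : IsConformalOn Gbar V σ Ω) {y : F} (hy : y ∈ Ω) {c : ℝ}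
    (hc : ∀ u v w, riemann Gbar y u v w = c • (Gbar y v w • u - Gbar y u w • v)) (a w v : F) :
    Gbar y (secondCovDeriv Gbar V y a w) v
      = c * (Gbar y (V y) w * Gbar y a v - Gbar y a w * Gbar y (V y) v)
        + fderiv ℝ σ y a * Gbar y w v + fderiv ℝ σ y w * Gbar y a v
        - fderiv ℝ σ y v * Gbar y a w := by
  have A : ∀ a w v : F, Gbar y (secondCovDeriv Gbar V y a w) v
      - Gbar y (secondCovDeriv Gbar V y w a) v
      = c * (Gbar y (V y) w * Gbar y a v - Gbar y (V y) a * Gbar y w v) := by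
    intro a w v
    have := congrArg (fun x => Gbar y x v)
      (secondCovDeriv_sub hG hy (hV.contDiffAt_field hG hy) a w)
    simp only [hc, map_sub, sub_apply, map_smul, smul_apply, smul_eq_mul] at this
    rw [this, hG.symm y hy (V y) w, hG.symm y hy (V y) a]
  -- As in the Koszul formula, a trilinear form is determined by its antisymmetric part in the first
  -- two slots (`A`) and its symmetric part in the last two (`S`).
  have S := hV.inner_secondCovDeriv_add hG hy
  linarith [S a w v, S w a v, S v a w, A a w v, A a v w, A w v a, hG.symm y hy v w,
    hG.symm y hy a w, hG.symm y hy a v, congrArg (fun t => fderiv ℝ σ y v * t) (hG.symm y hy a w),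
    congrArg (fun t => fderiv ℝ σ y a * t) (hG.symm y hy v w),
    congrArg (fun t => fderiv ℝ σ y w * t) (hG.symm y hy a v),
    congrArg (fun t => c * (Gbar y (V y) v * t)) (hG.symm y hy a w),
    congrArg (fun t => c * (Gbar y (V y) a * t)) (hG.symm y hy v w),
    congrArg (fun t => c * (Gbar y (V y) w * t)) (hG.symm y hy a v)]

end Conformal

/-! ### Hypersurfaces: the Gauss and Weingarten formulas -/

/-- `f` is an isometric immersion of the Riemannian metric `G` on `U` as a hypersurface with
respect to the metric `Gbar` on `Ω`, with unit normal field `N` of sign `ε`. -/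
structure IsHypersurfaceOn (G : E → E →L[ℝ] E →L[ℝ] ℝ) (Gbar : F → F →L[ℝ] F →L[ℝ] ℝ)
    (f N : E → F) (ε : ℝ) (U : Set E) (Ω : Set F) : Prop where
  metric : IsMetricOn G U
  metric' : IsMetricOn Gbar Ω
  pos : ∀ y ∈ U, ∀ u, u ≠ 0 → 0 < G y u u
  mapsTo : Set.MapsTo f U Ω
  contDiffOn : ContDiffOn ℝ ∞ f U
  contDiffOn_normal : ContDiffOn ℝ ∞ N U
  pullback_eq : ∀ y ∈ U, ∀ u v, Gbar (f y) (fderiv ℝ f y u) (fderiv ℝ f y v) = G y u v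
  sign : ε = 1 ∨ ε = -1
  unit : ∀ y ∈ U, Gbar (f y) (N y) (N y) = ε
  normal : ∀ y ∈ U, ∀ u, Gbar (f y) (N y) (fderiv ℝ f y u) = 0

namespace IsHypersurfaceOn

variable {G : E → E →L[ℝ] E →L[ℝ] ℝ} {f N : E → F} {ε : ℝ} {U : Set E}

section Basic

variable (h : IsHypersurfaceOn G Gbar f N ε U Ω) {y : E} (hy : y ∈ U)
include h

lemma sign_mul_self : ε * ε = 1 := by
  rcases h.sign with h | h <;> simp [h]

include hy

lemma contDiffAt : ContDiffAt ℝ ∞ f y :=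
  h.contDiffOn.contDiffAt (h.metric.isOpen.mem_nhds hy)

lemma contDiffAt_normal : ContDiffAt ℝ ∞ N y :=
  h.contDiffOn_normal.contDiffAt (h.metric.isOpen.mem_nhds hy)

lemma differentiableAt : DifferentiableAt ℝ f y := (h.contDiffAt hy).differentiableAt (by simp)

lemma differentiableAt_normal : DifferentiableAt ℝ N y :=
  (h.contDiffAt_normal hy).differentiableAt (by simp)

lemma fderiv_injective : Function.Injective (fderiv ℝ f y) := by
  rw [injective_iff_map_eq_zero]
  intro u hu
  by_contra hne
  have := h.pos y hy u hne
  rw [← h.pullback_eq y hy, hu] at this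
  simp at this

variable [FiniteDimensional ℝ E] [FiniteDimensional ℝ F]

/-- By dimension count the image of `df` and the normal `N` span the ambient space, so nondegeneracy
need only be tested on them. Vector identities along `f` are proved through this. -/
lemma eq_zero (hdim : Module.finrank ℝ F = Module.finrank ℝ E + 1) {x : F}
    (hx : ∀ w, Gbar (f y) x (fderiv ℝ f y w) = 0) (hxN : Gbar (f y) x (N y) = 0) : x = 0 := by
  let L : E × ℝ →ₗ[ℝ] F :=
    (fderiv ℝ f y : E →ₗ[ℝ] F).coprod (LinearMap.toSpanSingleton ℝ F (N y))
  have hL : ∀ w t, L (w, t) = fderiv ℝ f y w + t • N y := fun w t => by simp [L]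
  have hε := h.sign_mul_self
  have hinj : Function.Injective L := by
    rw [injective_iff_map_eq_zero]
    rintro ⟨w, t⟩ hwt
    rw [hL] at hwt
    have h1 := congrArg (Gbar (f y) (N y)) hwt
    simp only [map_add, map_smul, h.normal y hy, h.unit y hy, smul_eq_mul, map_zero,
      zero_add] at h1
    have ht : t = 0 := by linear_combination ε * h1 - t * hε
    subst ht
    rw [zero_smul, add_zero] at hwt
    rw [(injective_iff_map_eq_zero _).1 (h.fderiv_injective hy) w hwt]
    rfl
  have hsurj : Function.Surjective L :=
    (LinearMap.injective_iff_surjective_of_finrank_eq_finrank (by simp [hdim])).1 hinj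
  refine h.metric'.nondegenerate _ (h.mapsTo hy) x fun v => ?_
  obtain ⟨⟨w, t⟩, rfl⟩ := hsurj v
  rw [hL, map_add, map_smul, hx, hxN]
  simp

/-- The Weingarten formula at an umbilic point. -/
lemma covAlong_normal (hdim : Module.finrank ℝ F = Module.finrank ℝ E + 1) {μ : ℝ}
    (hμ : ∀ u v, secondForm Gbar f N y u v = μ * G y u v) (u : E) :
    covAlong Gbar f N y u = -μ • fderiv ℝ f y u := by
  rw [← sub_eq_zero]
  refine h.eq_zero hy hdim (fun w => ?_) ?_
  · have := hμ u w
    rw [secondForm] at this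
    simp only [map_sub, sub_apply, map_smul, smul_apply, smul_eq_mul, h.pullback_eq y hy]
    linarith
  -- The derivative of `N` has no normal component because `⟨N, N⟩` is constant.
  · have h1 : (fun z => Gbar (f z) (N z) (N z)) =ᶠ[nhds y] fun _ => ε := by
      filter_upwards [h.metric.isOpen.mem_nhds hy] with z hz using h.unit z hz
    have h2 := congrArg (fun l : E →L[ℝ] ℝ => l u) h1.fderiv_eq
    have hN := h.differentiableAt_normal hy
    have hs := h.metric'.symm _ (h.mapsTo hy)
    rw [h.metric'.fderiv_inner (h.mapsTo hy) (h.differentiableAt hy) hN hN] at h2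
    simp only [fderiv_fun_const, Pi.zero_apply, zero_apply] at h2
    simp only [map_sub, sub_apply, map_smul, smul_apply, smul_eq_mul,
      hs (fderiv ℝ f y u) (N y), h.normal y hy]
    linarith [hs (N y) (covAlong Gbar f N y u)]

/-- The Gauss formula paired with tangent vectors. -/
lemma inner_covAlong_fderiv (u v w : E) :
    Gbar (f y) (covAlong Gbar f (fun z => fderiv ℝ f z v) y u) (fderiv ℝ f y w)
      = G y (christoffelCLM G y u v) w := by
  have hf := h.contDiffAt hy
  -- Differentiating `f^* Gbar = G` turns each term of the Christoffel formula into ambient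
  -- covariant derivatives; torsion-freeness then collapses the alternating sum.
  have key : ∀ a b d : E, fderiv ℝ G y a b d
      = Gbar (f y) (covAlong Gbar f (fun z => fderiv ℝ f z b) y a) (fderiv ℝ f y d)
        + Gbar (f y) (fderiv ℝ f y b) (covAlong Gbar f (fun z => fderiv ℝ f z d) y a) := by
    intro a b d
    rw [← h.metric'.fderiv_inner (h.mapsTo hy) (h.differentiableAt hy)
      (differentiableAt_fderiv_apply hf b) (differentiableAt_fderiv_apply hf d)]
    have hev : (fun z => Gbar (f z) (fderiv ℝ f z b) (fderiv ℝ f z d))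
        =ᶠ[nhds y] fun z => G z b d := by
      filter_upwards [h.metric.isOpen.mem_nhds hy] with z hz using h.pullback_eq z hz b d
    have := fderiv_clm_apply₂ (h.metric.differentiableAt hy)
      (differentiableAt_const b) (differentiableAt_const d) a
    rw [hev.fderiv_eq, this]
    simp
  have T := h.metric'.covAlong_fderiv_symm (h.mapsTo hy) hf
  have hs := h.metric'.symm _ (h.mapsTo hy)
  rw [h.metric.apply_christoffel hy, key, key, key, hs (fderiv ℝ f y v), hs (fderiv ℝ f y u),
    hs (fderiv ℝ f y u), T v u, T w u, T w v]
  ring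

/-- The Gauss formula at an umbilic point. -/
lemma covAlong_fderiv (hdim : Module.finrank ℝ F = Module.finrank ℝ E + 1) {μ : ℝ}
    (hμ : ∀ u v, secondForm Gbar f N y u v = μ * G y u v) (u v : E) :
    covAlong Gbar f (fun z => fderiv ℝ f z v) y u
      = fderiv ℝ f y (christoffelCLM G y u v) + (ε * μ * G y u v) • N y := by
  have hs := h.metric'.symm _ (h.mapsTo hy)
  rw [← sub_eq_zero]
  refine h.eq_zero hy hdim (fun w => ?_) ?_
  · simp only [map_sub, map_add, sub_apply, add_apply, map_smul, smul_apply, smul_eq_mul,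
      h.normal y hy, h.pullback_eq y hy, h.inner_covAlong_fderiv hy]
    ring
  -- Differentiating `⟨N, df(v)⟩ = 0` gives the normal component; the factor `ε` enters because `⟨N,
  -- N⟩ = ε = ε⁻¹`.
  · have h1 : (fun z => Gbar (f z) (N z) (fderiv ℝ f z v)) =ᶠ[nhds y] fun _ => 0 := by
      filter_upwards [h.metric.isOpen.mem_nhds hy] with z hz using h.normal z hz v
    have h2 := congrArg (fun l : E →L[ℝ] ℝ => l u) h1.fderiv_eq
    rw [h.metric'.fderiv_inner (h.mapsTo hy) (h.differentiableAt hy)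
      (h.differentiableAt_normal hy) (differentiableAt_fderiv_apply (h.contDiffAt hy) v),
      h.covAlong_normal hy hdim hμ] at h2
    simp only [fderiv_fun_const, Pi.zero_apply, zero_apply, map_smul, smul_apply,
      h.pullback_eq y hy, smul_eq_mul] at h2
    simp only [map_sub, map_add, sub_apply, add_apply, map_smul, smul_apply, smul_eq_mul,
      h.unit y hy, hs _ (N y), h.normal y hy]
    linear_combination h2 - μ * G y u v * h.sign_mul_self

-- Two independent tangent vectors span a plane on which the form is positive definite. This is the
-- reference plane required by `IsMetricOn.riemann_eq_of_sectional`.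
omit [FiniteDimensional ℝ F] in
lemma exists_planeDet_ne_zero (hE : 2 ≤ Module.finrank ℝ E) :
    ∃ a b : F, planeDet Gbar (f y) a b ≠ 0 := by
  obtain ⟨v, hv⟩ := Module.finrank_pos_iff_exists_ne_zero (R := ℝ).1 (by omega : 0 < Module.finrank ℝ E)
  obtain ⟨w, hw⟩ := exists_linearIndependent_pair_of_one_lt_finrank
    (by omega : 1 < Module.finrank ℝ E) hv
  refine ⟨fderiv ℝ f y v, fderiv ℝ f y w, ?_⟩
  have hvv := h.pos y hy v hv
  -- The unnormalised Gram–Schmidt vector; its squared length is `G(v,v)` times the determinant of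
  -- the plane.
  have hne : G y v v • w - G y v w • v ≠ 0 := by
    intro h0
    have := LinearIndependent.pair_iff.1 hw (-G y v w) (G y v v) (by rw [← h0]; module)
    exact hvv.ne' this.2
  have hp := h.pos y hy _ hne
  simp only [map_sub, map_smul, sub_apply, smul_apply, smul_eq_mul,
    h.metric.symm y hy w v] at hp
  simp only [planeDet, h.pullback_eq y hy]
  intro h0
  have : (0 : ℝ) < G y v v * (G y v v * G y w w - G y v w ^ 2) := by linarith
  rw [h0] at this
  simp at this

lemma riemann_eq (hE : 2 ≤ Module.finrank ℝ E) {c : ℝ}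
    (hc : ∀ x ∈ Ω, ∀ u v, planeDet Gbar x u v ≠ 0 → sectional Gbar x u v = c) (u v w : F) :
    riemann Gbar (f y) u v w = c • (Gbar (f y) v w • u - Gbar (f y) u w • v) := by
  obtain ⟨a, b, hab⟩ := h.exists_planeDet_ne_zero hy hE
  exact h.metric'.riemann_eq_of_sectional (h.mapsTo hy) (hc _ (h.mapsTo hy)) hab u v w

omit [FiniteDimensional ℝ E] [FiniteDimensional ℝ F] in
/-- A covector `l` with `l(u) df(v) = l(v) df(u)` vanishes. -/
lemma covector_eq_zero (hE : 2 ≤ Module.finrank ℝ E) {l : E →L[ℝ] ℝ}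
    (hl : ∀ u v, l u • fderiv ℝ f y v = l v • fderiv ℝ f y u) : l = 0 := by
  ext v
  by_cases hv : v = 0
  · simp [hv]
  obtain ⟨w, hw⟩ := exists_linearIndependent_pair_of_one_lt_finrank
    (by omega : 1 < Module.finrank ℝ E) hv
  have h1 : l v • w - l w • v = 0 := by
    apply h.fderiv_injective hy
    simp [hl v w]
  exact (LinearIndependent.pair_iff.1 hw (-l w) (l v) (by rw [← h1]; module)).2

end Basic

end IsHypersurfaceOn

end Hypersurface

/-! ### Umbilic hypersurfaces: Codazzi and the angle function -/

section UmbilicHypersurface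

set_option maxSynthPendingDepth 3

variable {E F : Type*} [NormedAddCommGroup E] [NormedSpace ℝ E]
  [NormedAddCommGroup F] [NormedSpace ℝ F] [FiniteDimensional ℝ E] [FiniteDimensional ℝ F]
  {G : E → E →L[ℝ] E →L[ℝ] ℝ} {Gbar : F → F →L[ℝ] F →L[ℝ] ℝ} {U : Set E} {Ω : Set F}
  {f N : E → F} {ε : ℝ}

namespace IsHypersurfaceOn

/-- The umbilic factor is differentiable. -/
lemma differentiableAt_factor (h : IsHypersurfaceOn G Gbar f N ε U Ω)
    (hE : 2 ≤ Module.finrank ℝ E) {μ : E → ℝ}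
    (hμ : ∀ y ∈ U, ∀ u v, secondForm Gbar f N y u v = μ y * G y u v) {y : E} (hy : y ∈ U) :
    DifferentiableAt ℝ μ y := by
  obtain ⟨u, hu⟩ := (Module.finrank_pos_iff_exists_ne_zero (R := ℝ)).1
    (by omega : 0 < Module.finrank ℝ E)
  have hf := h.contDiffAt hy
  have hGf : DifferentiableAt ℝ (fun z => Gbar (f z)) y :=
    (h.metric'.differentiableAt (h.mapsTo hy)).comp y (h.differentiableAt hy)
  have hD : DifferentiableAt ℝ (fun z => covAlong Gbar f N z u) y :=
    (contDiffAt_covAlong h.metric' (h.mapsTo hy) hf (h.contDiffAt_normal hy) u).differentiableAt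
      (by simp)
  -- No regularity of `μ` is assumed: it is recovered as a quotient of smooth functions, evaluated
  -- on one fixed nonzero vector.
  have h1 : DifferentiableAt ℝ (fun z => secondForm Gbar f N z u u / G z u u) y := by
    have h2 : DifferentiableAt ℝ (fun z => G z u u) y :=
      ((h.metric.differentiableAt hy).clm_apply (differentiableAt_const u)).clm_apply
        (differentiableAt_const u)
    have h3 : DifferentiableAt ℝ (fun z => secondForm Gbar f N z u u) y :=
      ((hGf.clm_apply hD).clm_apply (differentiableAt_fderiv_apply hf u)).fun_neg
    have h4 : (fun z => G z u u) y ≠ 0 := (h.pos y hy u hu).ne'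
    simp only [div_eq_mul_inv]
    exact h3.fun_mul (h2.fun_inv h4)
  refine h1.congr_of_eventuallyEq ?_
  filter_upwards [h.metric.isOpen.mem_nhds hy] with z hz
  rw [hμ z hz, mul_div_cancel_right₀ _ (h.pos z hz u hu).ne']

/-- By the equation of Codazzi, the umbilic factor is locally constant. -/
lemma fderiv_factor_eq_zero (h : IsHypersurfaceOn G Gbar f N ε U Ω)
    (hE : 2 ≤ Module.finrank ℝ E) (hdim : Module.finrank ℝ F = Module.finrank ℝ E + 1) {c : ℝ}
    (hc : ∀ x ∈ Ω, ∀ u v, planeDet Gbar x u v ≠ 0 → sectional Gbar x u v = c) {μ : E → ℝ}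
    (hμ : ∀ y ∈ U, ∀ u v, secondForm Gbar f N y u v = μ y * G y u v) {y : E} (hy : y ∈ U) :
    fderiv ℝ μ y = 0 := by
  refine h.covector_eq_zero hy hE fun u v => ?_
  have hf := h.contDiffAt hy
  have hd := h.differentiableAt_factor hE hμ hy
  have key : ∀ a b, covAlong Gbar f (fun z => covAlong Gbar f N z b) y a
      = -(fderiv ℝ μ y a) • fderiv ℝ f y b
        + -μ y • covAlong Gbar f (fun z => fderiv ℝ f z b) y a := by
    intro a b
    have hev : (fun z => covAlong Gbar f N z b) =ᶠ[nhds y] fun z => (-μ z) • fderiv ℝ f z b := by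
      filter_upwards [h.metric.isOpen.mem_nhds hy] with z hz
      exact h.covAlong_normal hz hdim (hμ z hz) b
    rw [covAlong_congr hev, covAlong_fun_smul hd.fun_neg (differentiableAt_fderiv_apply hf b),
      fderiv_fun_neg]
    rfl
  -- The curvature side vanishes since `N` is orthogonal to both `df(u)` and `df(v)`, and the second
  -- derivatives of `f` cancel by torsion-freeness.
  have R := covAlong_covAlong_sub h.metric' (h.mapsTo hy) hf (h.contDiffAt_normal hy) u v
  have hs := h.metric'.symm _ (h.mapsTo hy)
  rw [h.riemann_eq hy hE hc, key, key, hs _ (N y), hs _ (N y), h.normal y hy, h.normal y hy,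
    h.metric'.covAlong_fderiv_symm (h.mapsTo hy) hf v u] at R
  rw [← sub_eq_zero, ← neg_eq_zero, ← smul_zero c]
  simp only [zero_smul, sub_zero] at R
  rw [← R]
  module

variable {V : F → F} {σ : F → ℝ} {c μ : ℝ}

omit [FiniteDimensional ℝ E] [FiniteDimensional ℝ F] in
/-- The function `-(dσ(N) + μ σ)` along a hypersurface is smooth. -/
lemma contDiffAt_potential (h : IsHypersurfaceOn G Gbar f N ε U Ω)
    (hV : IsConformalOn Gbar V σ Ω) {y : E} (hy : y ∈ U) (μ : ℝ) :
    ContDiffAt ℝ ∞ (fun z => -(fderiv ℝ σ (f z) (N z) + μ * σ (f z))) y := by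
  have hσ := hV.contDiffAt_factor h.metric' (h.mapsTo hy)
  have hσ' : ContDiffAt ℝ ∞ (fun z => fderiv ℝ σ (f z)) y :=
    (hσ.fderiv_right (m := ∞) (by simp)).comp y (h.contDiffAt hy)
  exact ((hσ'.clm_apply (h.contDiffAt_normal hy)).add
    (contDiffAt_const.mul (hσ.comp y (h.contDiffAt hy)))).neg

/-- The field `∇_N V + μ V - σ N` along an umbilic hypersurface. -/
def closedField (Gbar : F → F →L[ℝ] F →L[ℝ] ℝ) (f N : E → F) (V : F → F) (σ : F → ℝ) (μ : ℝ)
    (z : E) : F :=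
  covDeriv Gbar V (f z) (N z) + μ • V (f z) + (-σ (f z)) • N z

variable (h : IsHypersurfaceOn G Gbar f N ε U Ω) (hE : 2 ≤ Module.finrank ℝ E)
  (hdim : Module.finrank ℝ F = Module.finrank ℝ E + 1)
  (hc : ∀ x ∈ Ω, ∀ u v, planeDet Gbar x u v ≠ 0 → sectional Gbar x u v = c)
  (hμ : ∀ y ∈ U, ∀ u v, secondForm Gbar f N y u v = μ * G y u v)
  (hV : IsConformalOn Gbar V σ Ω) {y : E} (hy : y ∈ U)

omit [FiniteDimensional ℝ E] in
include h hV hy in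
lemma contDiffAt_closedField : ContDiffAt ℝ ∞ (closedField Gbar f N V σ μ) y := by
  have hΩ := h.mapsTo hy
  have hf := h.contDiffAt hy
  have hN := h.contDiffAt_normal hy
  have hVf := hV.contDiffAt_field h.metric' hΩ
  have hL : ContDiffAt ℝ ∞ (fun z => covDeriv Gbar V (f z)) y :=
    (contDiffAt_covDeriv h.metric' hΩ hVf).comp y hf
  have hVc : ContDiffAt ℝ ∞ (fun z => V (f z)) y := hVf.comp y hf
  have hσ : ContDiffAt ℝ ∞ (fun z => σ (f z)) y :=
    (hV.contDiffAt_factor h.metric' hΩ).comp y hf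
  exact ((hL.clm_apply hN).add (contDiffAt_const.smul hVc)).add (hσ.neg.smul hN)

include h hE hdim hc hμ hV hy

/-- Each term of `Z` repairs another: `∇̄_{∇̄_u N} V = -μ ∇̄_u V` cancels the derivative of `μ V`,
and the part `dσ(u) N` of the second covariant derivative cancels against that of `-σ N`. Only
multiples of `df(u)` remain. -/
lemma covAlong_closedField (u : E) :
    covAlong Gbar f (closedField Gbar f N V σ μ) y u
      = (c * Gbar (f y) (V (f y)) (N y) + (fderiv ℝ σ (f y) (N y) + μ * σ (f y)))
        • fderiv ℝ f y u := by
  have hΩ := h.mapsTo hy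
  have hf := h.differentiableAt hy
  have hN := h.differentiableAt_normal hy
  have hVf := hV.contDiffAt_field h.metric' hΩ
  have hVd : DifferentiableAt ℝ V (f y) := hVf.differentiableAt (by simp)
  have hσd : DifferentiableAt ℝ σ (f y) :=
    (hV.contDiffAt_factor h.metric' hΩ).differentiableAt (by simp)
  have hL : DifferentiableAt ℝ (fun z => covDeriv Gbar V (f z)) y :=
    ((contDiffAt_covDeriv h.metric' hΩ hVf).differentiableAt (by simp)).comp y hf
  have hVc : DifferentiableAt ℝ (fun z => V (f z)) y := hVd.comp y hf
  have hσ : DifferentiableAt ℝ (fun z => σ (f z)) y := hσd.comp y hf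
  have hσ' : fderiv ℝ (fun z => σ (f z)) y u = fderiv ℝ σ (f y) (fderiv ℝ f y u) := by
    have := fderiv_comp y hσd hf
    simp only [Function.comp_def] at this
    rw [this]; rfl
  have hs := h.metric'.symm _ hΩ
  have e1 := covAlong_covDeriv h.metric' hΩ hf hN hVf u
  have e2 := covAlong_fun_smul (Gbar := Gbar) (f := f) (differentiableAt_const μ) hVc u
  have e3 := covAlong_fun_smul (Gbar := Gbar) (f := f) hσ.fun_neg hN u
  rw [covAlong_comp hf hVd] at e2
  rw [fderiv_fun_neg, neg_apply, hσ', h.covAlong_normal hy hdim (hμ y hy)] at e3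
  rw [h.covAlong_normal hy hdim (hμ y hy)] at e1
  have hsum : covAlong Gbar f (closedField Gbar f N V σ μ) y u = _ :=
    (covAlong_fun_add (f := f) ((hL.clm_apply hN).fun_add (hVc.fun_const_smul μ))
      (hσ.fun_neg.fun_smul hN) u)
  rw [hsum, covAlong_fun_add (hL.clm_apply hN) (hVc.fun_const_smul μ), e1, e2, e3]
  refine h.metric'.ext hΩ fun v => ?_
  simp only [map_add, add_apply, map_smul, smul_apply, smul_eq_mul,
    hV.inner_secondCovDeriv h.metric' hΩ (h.riemann_eq hy hE hc), hs (fderiv ℝ f y u) (N y),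
    h.normal y hy, fderiv_fun_const, Pi.zero_apply, zero_apply, zero_smul, map_zero]
  ring

omit hE hc in
/-- The gradient of the angle function. -/
lemma fderiv_angle (v : E) :
    fderiv ℝ (fun z => Gbar (f z) (V (f z)) (N z)) y v
      = -Gbar (f y) (closedField Gbar f N V σ μ y) (fderiv ℝ f y v) := by
  have hΩ := h.mapsTo hy
  have hf := h.differentiableAt hy
  have hN := h.differentiableAt_normal hy
  have hVd : DifferentiableAt ℝ V (f y) :=
    (hV.contDiffAt_field h.metric' hΩ).differentiableAt (by simp)
  have hVc : DifferentiableAt ℝ (fun z => V (f z)) y := hVd.comp y hf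
  have hs := h.metric'.symm _ hΩ
  have e := hV.inner_covDeriv h.metric' hΩ (N y) (fderiv ℝ f y v)
  rw [h.metric'.fderiv_inner hΩ hf hVc hN, covAlong_comp hf hVd,
    h.covAlong_normal hy hdim (hμ y hy), closedField]
  simp only [map_add, add_apply, map_smul, smul_apply, smul_eq_mul, h.normal y hy] at e ⊢
  rw [hs _ (N y)]
  linarith

omit [FiniteDimensional ℝ E] [FiniteDimensional ℝ F] hE hdim hc hμ in
lemma contDiffAt_angle : ContDiffAt ℝ ∞ (fun z => Gbar (f z) (V (f z)) (N z)) y := by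
  have hΩ := h.mapsTo hy
  have hf := h.contDiffAt hy
  have hGf : ContDiffAt ℝ ∞ (fun z => Gbar (f z)) y := (h.metric'.contDiffAt hΩ).comp y hf
  have hVc : ContDiffAt ℝ ∞ (fun z => V (f z)) y :=
    (hV.contDiffAt_field h.metric' hΩ).comp y hf
  exact (hGf.clm_apply hVc).clm_apply (h.contDiffAt_normal hy)

/-- The derivative of `df(v)` splits by the Gauss formula. Its tangential part is removed by the
Christoffel term of the Hessian, and its normal part pairs with `Z` to give the summand `ε μ² C`. -/
lemma hessian_angle (u v : E) :
    hessian G (fun z => Gbar (f z) (V (f z)) (N z)) y u v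
      = (-(c + ε * μ ^ 2) * Gbar (f y) (V (f y)) (N y)
          + -(fderiv ℝ σ (f y) (N y) + μ * σ (f y))) * G y u v := by
  have hΩ := h.mapsTo hy
  have hf := h.contDiffAt hy
  have hs := h.metric'.symm _ hΩ
  have hZ : DifferentiableAt ℝ (closedField Gbar f N V σ μ) y :=
    (h.contDiffAt_closedField hV hy).differentiableAt (by simp)
  have hev : (fun z => fderiv ℝ (fun z => Gbar (f z) (V (f z)) (N z)) z v) =ᶠ[nhds y]
      fun z => -Gbar (f z) (closedField Gbar f N V σ μ z) (fderiv ℝ f z v) := by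
    filter_upwards [h.metric.isOpen.mem_nhds hy] with z hz
    exact h.fderiv_angle hdim hμ hV hz v
  rw [hessian, ← fderiv_fderiv_apply (h.contDiffAt_angle hV hy), hev.fderiv_eq, fderiv_fun_neg,
    neg_apply, h.metric'.fderiv_inner hΩ (h.differentiableAt hy) hZ
      (differentiableAt_fderiv_apply hf v), h.covAlong_closedField hE hdim hc hμ hV hy,
    h.fderiv_angle hdim hμ hV hy, h.covAlong_fderiv hy hdim (hμ y hy), ← christoffelCLM_apply]
  -- Conformality on the pair `(N, N)` gives `⟨∇̄_N V, N⟩ = σ ⟨N, N⟩`, which the term `-σ N`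
  -- cancels.
  have hNZ : Gbar (f y) (closedField Gbar f N V σ μ y) (N y)
      = μ * Gbar (f y) (V (f y)) (N y) := by
    have e := hV.inner_covDeriv h.metric' hΩ (N y) (N y)
    rw [hs (N y) (covDeriv Gbar V (f y) (N y))] at e
    simp only [closedField, map_add, add_apply, map_smul, smul_apply, smul_eq_mul]
    linear_combination (1 / 2) * e
  simp only [map_add, map_smul, smul_apply, smul_eq_mul, h.pullback_eq y hy, hNZ]
  ring

/-- Commuting derivatives of `Z` compares `d(c C - b)(u) df(v) - d(c C - b)(v) df(u)` with `c
(⟨df(v), Z⟩ df(u) - ⟨df(u), Z⟩ df(v))`. As `dC = -⟨Z, df⟩`, the terms with `c` agree and those in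
`db` must vanish. -/
lemma fderiv_potential_eq_zero :
    fderiv ℝ (fun z => -(fderiv ℝ σ (f z) (N z) + μ * σ (f z))) y = 0 := by
  refine h.covector_eq_zero hy hE fun u v => ?_
  have hΩ := h.mapsTo hy
  have hf := h.contDiffAt hy
  have hs := h.metric'.symm _ hΩ
  have hC : DifferentiableAt ℝ (fun z => Gbar (f z) (V (f z)) (N z)) y :=
    (h.contDiffAt_angle hV hy).differentiableAt (by simp)
  have hb := (h.contDiffAt_potential hV hy μ).differentiableAt (by simp)
  have hcb := (hC.const_mul c).fun_sub hb
  have key : ∀ u v, covAlong Gbar f (fun z => covAlong Gbar f (closedField Gbar f N V σ μ) z v) y u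
      = (-(c * Gbar (f y) (closedField Gbar f N V σ μ y) (fderiv ℝ f y u))
          - fderiv ℝ (fun z => -(fderiv ℝ σ (f z) (N z) + μ * σ (f z))) y u) • fderiv ℝ f y v
        + (c * Gbar (f y) (V (f y)) (N y) - -(fderiv ℝ σ (f y) (N y) + μ * σ (f y)))
          • covAlong Gbar f (fun z => fderiv ℝ f z v) y u := by
    intro u v
    have hev : (fun z => covAlong Gbar f (closedField Gbar f N V σ μ) z v) =ᶠ[nhds y]
        fun z => (c * Gbar (f z) (V (f z)) (N z) - -(fderiv ℝ σ (f z) (N z) + μ * σ (f z)))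
          • fderiv ℝ f z v := by
      filter_upwards [h.metric.isOpen.mem_nhds hy] with z hz
      rw [h.covAlong_closedField hE hdim hc hμ hV hz, sub_neg_eq_add]
    rw [covAlong_congr hev, covAlong_fun_smul hcb (differentiableAt_fderiv_apply hf v),
      fderiv_fun_sub (hC.const_mul c) hb, fderiv_const_mul hC, sub_apply, smul_apply,
      h.fderiv_angle hdim hμ hV hy, smul_eq_mul, mul_neg]
  have R := covAlong_covAlong_sub h.metric' hΩ hf (h.contDiffAt_closedField hV hy (μ := μ)) u v
  rw [h.riemann_eq hy hE hc, key, key, hs _ (closedField Gbar f N V σ μ y),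
    hs _ (closedField Gbar f N V σ μ y), h.metric'.covAlong_fderiv_symm hΩ hf v u,
    ← sub_eq_zero] at R
  rw [← sub_eq_zero, ← neg_eq_zero, ← R]
  module

end IsHypersurfaceOn

end UmbilicHypersurface

/-! ### Transfer from manifolds to charts -/

section Charts

open Bundle

variable {n m : ℕ}
  {M : Type*} [TopologicalSpace M] [ChartedSpace (Eu n) M] [IsManifold (𝓡 n) ∞ M]
  {M' : Type*} [TopologicalSpace M'] [ChartedSpace (Eu m) M'] [IsManifold (𝓡 m) ∞ M']
  {e : OpenPartialHomeomorph M (Eu n)} {e' : OpenPartialHomeomorph M' (Eu m)}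

omit [IsManifold (𝓡 n) ∞ M] in
lemma mdifferentiable_of_mem_charts (he : e ∈ charts n M) : e.MDifferentiable (𝓡 n) (𝓡 n) :=
  ⟨(contMDiffOn_of_mem_maximalAtlas he).mdifferentiableOn (by simp),
    (contMDiffOn_symm_of_mem_maximalAtlas he).mdifferentiableOn (by simp)⟩

omit [IsManifold (𝓡 n) ∞ M] in
lemma mfderiv_symm_mfderiv (he : e ∈ charts n M) {p : M} (hp : p ∈ e.source)
    (v : TangentSpace (𝓡 n) p) :
    mfderiv (𝓡 n) (𝓡 n) e.symm (e p) (mfderiv (𝓡 n) (𝓡 n) e p v) = v := by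
  have := (mdifferentiable_of_mem_charts he).symm_comp_deriv hp
  exact congrArg (fun l : TangentSpace (𝓡 n) p →L[ℝ] TangentSpace (𝓡 n) p => l v) this

omit [IsManifold (𝓡 n) ∞ M] in
lemma mfderiv_mfderiv_symm (he : e ∈ charts n M) {y : Eu n} (hy : y ∈ e.target)
    (v : Eu n) :
    mfderiv (𝓡 n) (𝓡 n) e (e.symm y) (mfderiv (𝓡 n) (𝓡 n) e.symm y v) = v := by
  have := (mdifferentiable_of_mem_charts he).comp_symm_deriv hy
  exact congrArg (fun l : Eu n →L[ℝ] Eu n => l v) this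

/-- The coordinate vector fields are smooth. -/
lemma contMDiffOn_mfderiv_symm (he : e ∈ charts n M) (v : Eu n) :
    ContMDiffOn (𝓡 n) (𝓡 n).tangent ∞
      (fun y => (⟨e.symm y, mfderiv (𝓡 n) (𝓡 n) e.symm y v⟩ : TangentBundle (𝓡 n) M))
      e.target := by
  have h1 : ContMDiffOn (𝓡 n).tangent (𝓡 n).tangent ∞
      (tangentMapWithin (𝓡 n) (𝓡 n) e.symm e.target) _ :=
    (contMDiffOn_symm_of_mem_maximalAtlas he).contMDiffOn_tangentMapWithin (by simp)
      e.open_target.uniqueMDiffOn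
  have h2 : ContMDiff (𝓡 n) (𝓡 n).tangent ∞
      (fun y => (⟨y, v⟩ : TangentBundle (𝓡 n) (Eu n))) :=
    contMDiff_vectorSpace_iff_contDiff.2 contDiff_const
  refine (h1.comp h2.contMDiffOn (fun y hy => hy)).congr fun y hy => ?_
  simp only [Function.comp_apply, tangentMapWithin, mfderivWithin_of_isOpen e.open_target hy]

omit [IsManifold (𝓡 n) ∞ M] in
/-- The coordinates of a smooth field along a map are smooth. -/
lemma contMDiffOn_mfderiv_apply (he' : e' ∈ charts m M') {f : M → M'}
    {N : ∀ p : M, TangentSpace (𝓡 m) (f p)}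
    (hN : ContMDiff (𝓡 n) (𝓡 m).tangent ∞ (fun p => (⟨f p, N p⟩ : TangentBundle (𝓡 m) M'))) :
    ContMDiffOn (𝓡 n) 𝓘(ℝ, Eu m) ∞
      (fun p => (mfderiv (𝓡 m) (𝓡 m) e' (f p) (N p) : Eu m)) (f ⁻¹' e'.source) := by
  have h1 : ContMDiffOn (𝓡 m).tangent (𝓡 m).tangent ∞
      (tangentMapWithin (𝓡 m) (𝓡 m) e' e'.source) _ :=
    (contMDiffOn_of_mem_maximalAtlas he').contMDiffOn_tangentMapWithin (by simp)
      e'.open_source.uniqueMDiffOn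
  have h2 := (contMDiff_snd_tangentBundle_modelSpace (n := ∞) (Eu m) (𝓡 m)).comp_contMDiffOn
    (h1.comp hN.contMDiffOn (fun p (hp : p ∈ f ⁻¹' e'.source) => hp))
  refine h2.congr fun p hp => ?_
  exact congrArg (fun L : TangentSpace (𝓡 m) (f p) →L[ℝ] Eu m => L (N p))
    (mfderivWithin_of_isOpen e'.open_source hp).symm

lemma contDiffOn_fieldIn (he : e ∈ charts n M) {V : ∀ x : M, TangentSpace (𝓡 n) x}
    (hV : ContMDiff (𝓡 n) (𝓡 n).tangent ∞ (fun x => (⟨x, V x⟩ : TangentBundle (𝓡 n) M))) :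
    ContDiffOn ℝ ∞ (fieldIn V e) e.target :=
  ((contMDiffOn_mfderiv_apply (f := fun x : M => x) he hV).comp
    (contMDiffOn_symm_of_mem_maximalAtlas he) fun _ hy => e.map_target hy).contDiffOn

/-- The coordinates of those points of the chart `e` that `f` maps into the domain of `e'`. -/
def mapInDomain (f : M → M') (e : OpenPartialHomeomorph M (Eu n))
    (e' : OpenPartialHomeomorph M' (Eu m)) : Set (Eu n) :=
  e.target ∩ e.symm ⁻¹' (f ⁻¹' e'.source)

omit [ChartedSpace (Eu n) M] [IsManifold (𝓡 n) ∞ M] [ChartedSpace (Eu m) M']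
  [IsManifold (𝓡 m) ∞ M'] in
lemma isOpen_mapInDomain {f : M → M'} (hf : Continuous f) : IsOpen (mapInDomain f e e') :=
  e.isOpen_inter_preimage_symm (e'.open_source.preimage hf)

omit [IsManifold (𝓡 n) ∞ M] in
lemma contDiffOn_alongIn (he : e ∈ charts n M) (he' : e' ∈ charts m M') {f : M → M'}
    {N : ∀ p : M, TangentSpace (𝓡 m) (f p)}
    (hN : ContMDiff (𝓡 n) (𝓡 m).tangent ∞ (fun p => (⟨f p, N p⟩ : TangentBundle (𝓡 m) M'))) :
    ContDiffOn ℝ ∞ (alongIn f N e e') (mapInDomain f e e') :=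
  ((contMDiffOn_mfderiv_apply he' hN).comp ((contMDiffOn_symm_of_mem_maximalAtlas he).mono
    Set.inter_subset_left) fun _ hy => hy.2).contDiffOn

omit [IsManifold (𝓡 n) ∞ M] [IsManifold (𝓡 m) ∞ M'] in
lemma contDiffOn_mapIn (he : e ∈ charts n M) (he' : e' ∈ charts m M') {f : M → M'}
    (hf : ContMDiff (𝓡 n) (𝓡 m) ∞ f) :
    ContDiffOn ℝ ∞ (mapIn f e e') (mapInDomain f e e') :=
  ((contMDiffOn_of_mem_maximalAtlas he').comp (hf.comp_contMDiffOn
    ((contMDiffOn_symm_of_mem_maximalAtlas he).mono Set.inter_subset_left))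
    fun _ hy => hy.2).contDiffOn

lemma contDiffOn_gram (he : e ∈ charts n M)
    {g : ∀ x : M, TangentSpace (𝓡 n) x →L[ℝ] TangentSpace (𝓡 n) x →L[ℝ] ℝ}
    (hg : ContMDiff (𝓡 n) ((𝓡 n).prod 𝓘(ℝ, Eu n →L[ℝ] Eu n →L[ℝ] ℝ)) ∞
      (fun x => Bundle.TotalSpace.mk' (Eu n →L[ℝ] Eu n →L[ℝ] ℝ)
        (E := fun x : M => TangentSpace (𝓡 n) x →L[ℝ] TangentSpace (𝓡 n) x →L[ℝ] ℝ) x (g x))) :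
    ContDiffOn ℝ ∞ (gram g e) e.target := by
  rw [contDiffOn_clm_apply]
  intro u
  rw [contDiffOn_clm_apply]
  intro v
  have h1 : ContMDiffOn (𝓡 n) ((𝓡 n).prod 𝓘(ℝ, ℝ)) ∞
      (fun y => TotalSpace.mk' ℝ (E := Bundle.Trivial M ℝ) (e.symm y)
        (g (e.symm y) (mfderiv (𝓡 n) (𝓡 n) e.symm y u) (mfderiv (𝓡 n) (𝓡 n) e.symm y v)))
      e.target := by
    apply ContMDiffOn.clm_bundle_apply₂ (F₁ := Eu n) (F₂ := Eu n)
    · exact hg.comp_contMDiffOn (contMDiffOn_symm_of_mem_maximalAtlas he)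
    · exact contMDiffOn_mfderiv_symm he u
    · exact contMDiffOn_mfderiv_symm he v
  refine ContMDiffOn.contDiffOn fun y hy => ?_
  have h2 := h1 y hy
  simp only [contMDiffWithinAt_totalSpace] at h2
  exact h2.2

omit [IsManifold (𝓡 n) ∞ M] in
lemma gram_apply (g : ∀ x : M, TangentSpace (𝓡 n) x →L[ℝ] TangentSpace (𝓡 n) x →L[ℝ] ℝ)
    (e : OpenPartialHomeomorph M (Eu n)) (y u v : Eu n) :
    gram g e y u v = g (e.symm y) (mfderiv (𝓡 n) (𝓡 n) e.symm y u)
      (mfderiv (𝓡 n) (𝓡 n) e.symm y v) := rfl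

omit [IsManifold (𝓡 n) ∞ M] in
lemma gram_mfderiv (he : e ∈ charts n M)
    (g : ∀ x : M, TangentSpace (𝓡 n) x →L[ℝ] TangentSpace (𝓡 n) x →L[ℝ] ℝ) {p : M}
    (hp : p ∈ e.source) (u v : TangentSpace (𝓡 n) p) :
    gram g e (e p) (mfderiv (𝓡 n) (𝓡 n) e p u) (mfderiv (𝓡 n) (𝓡 n) e p v) = g p u v := by
  -- The base points `e.symm (e p)` and `p` are only propositionally equal; the vectors are taken in
  -- the common model space so that the base point can be substituted.
  have h : ∀ q : M, q = p → ∀ a b : Eu n, g q a b = g p a b := by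
    rintro q rfl a b
    rfl
  exact (h _ (e.left_inv hp) _ _).trans (congrArg₂ (fun a b : TangentSpace (𝓡 n) p => g p a b)
    (mfderiv_symm_mfderiv he hp u) (mfderiv_symm_mfderiv he hp v))

omit [IsManifold (𝓡 n) ∞ M] in
lemma fieldIn_apply (V : ∀ x : M, TangentSpace (𝓡 n) x) {p : M} (hp : p ∈ e.source) :
    fieldIn V e (e p) = mfderiv (𝓡 n) (𝓡 n) e p (V p) := by
  have h : ∀ q : M, q = p → (mfderiv (𝓡 n) (𝓡 n) e q (V q) : Eu n)
      = mfderiv (𝓡 n) (𝓡 n) e p (V p) := by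
    rintro q rfl
    rfl
  exact h _ (e.left_inv hp)

lemma isMetricOn_gram (he : e ∈ charts n M) (g : SemiRiemannianMetric n M) :
    IsMetricOn (gram g.inner e) e.target where
  isOpen := e.open_target
  contDiffOn := contDiffOn_gram he g.contMDiff
  symm y _ u v := g.symm _ _ _
  nondegenerate y hy u hu := by
    have h0 : mfderiv (𝓡 n) (𝓡 n) e.symm y u = 0 := by
      refine g.nondegenerate _ _ fun w => ?_
      have h : ∀ z : Eu n, z = y → ∀ a : Eu n, (mfderiv (𝓡 n) (𝓡 n) e.symm z a : Eu n)
          = mfderiv (𝓡 n) (𝓡 n) e.symm y a := by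
        rintro z rfl a
        rfl
      -- Every tangent vector comes from a coordinate vector, so testing against coordinate vectors
      -- suffices.
      have h1 : mfderiv (𝓡 n) (𝓡 n) e.symm y (mfderiv (𝓡 n) (𝓡 n) e (e.symm y) w) = w :=
        (h _ (e.right_inv hy) _).symm.trans (mfderiv_symm_mfderiv he (e.map_target hy) w)
      exact (congrArg (g.inner (e.symm y) (mfderiv (𝓡 n) (𝓡 n) e.symm y u)) h1).symm.trans
        (hu (mfderiv (𝓡 n) (𝓡 n) e (e.symm y) w))
    rw [← mfderiv_mfderiv_symm he hy u, h0]
    exact map_zero _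

lemma isMetricOn_gram_riemannian (he : e ∈ charts n M) (g : RiemannianMetric n M) :
    IsMetricOn (gram g.inner e) e.target :=
  isMetricOn_gram he
    { inner := g.inner
      symm := g.symm
      nondegenerate := fun x v hv => by
        by_contra h
        exact (g.pos x v h).ne' (hv v)
      contMDiff := g.contMDiff }

lemma gram_pos (he : e ∈ charts n M) (g : RiemannianMetric n M) {y : Eu n} (hy : y ∈ e.target)
    {u : Eu n} (hu : u ≠ 0) : 0 < gram g.inner e y u u := by
  rw [gram_apply]
  refine g.pos _ _ fun h0 => hu ?_
  rw [← mfderiv_mfderiv_symm he hy u, h0]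
  exact map_zero _

omit [IsManifold (𝓡 n) ∞ M] [IsManifold (𝓡 m) ∞ M'] in
lemma fderiv_mapIn (he : e ∈ charts n M) (he' : e' ∈ charts m M') {f : M → M'}
    (hf : ContMDiff (𝓡 n) (𝓡 m) ∞ f) {y : Eu n} (hy : y ∈ mapInDomain f e e') (u : Eu n) :
    fderiv ℝ (mapIn f e e') y u
      = mfderiv (𝓡 m) (𝓡 m) e' (f (e.symm y)) (mfderiv (𝓡 n) (𝓡 m) f (e.symm y)
        (mfderiv (𝓡 n) (𝓡 n) e.symm y u)) := by
  have h1 := (mdifferentiable_of_mem_charts he).mdifferentiableAt_symm hy.1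
  have h2 : MDifferentiableAt (𝓡 n) (𝓡 m) f (e.symm y) := (hf _).mdifferentiableAt (by simp)
  have h3 := (mdifferentiable_of_mem_charts he').mdifferentiableAt hy.2
  have h4 : HasMFDerivAt (𝓡 n) (𝓡 m) (mapIn f e e') y _ :=
    h3.hasMFDerivAt.comp y (h2.hasMFDerivAt.comp y h1.hasMFDerivAt)
  rw [← mfderiv_eq_fderiv, h4.mfderiv]
  rfl

lemma isConformalOn (he : e ∈ charts n M) {g : SemiRiemannianMetric n M}
    {V : ∀ x : M, TangentSpace (𝓡 n) x} {σ : M → ℝ} (hV : IsConformalField g V σ) :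
    IsConformalOn (gram g.inner e) (fieldIn V e) (fun y => σ (e.symm y)) e.target where
  contDiffOn_field := contDiffOn_fieldIn he hV.contMDiff_field
  contDiffOn_factor := (hV.contMDiff_factor.comp_contMDiffOn
    (contMDiffOn_symm_of_mem_maximalAtlas he)).contDiffOn
  lieDeriv_eq := hV.lieDeriv_eq e he

variable {g : RiemannianMetric n M} {g' : SemiRiemannianMetric m M'} {f : M → M'}
  {N : ∀ p : M, TangentSpace (𝓡 m) (f p)} {ε : ℝ}

/-- The bridge by which all local statements apply to any pair of charts, on the part of the first
that `f` sends into the second. -/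
lemma isHypersurfaceOn (he : e ∈ charts n M) (he' : e' ∈ charts m M')
    (hf : IsIsometricImmersion g g' f) (hN : IsUnitNormal (n := n) g' f N ε) :
    IsHypersurfaceOn (gram g.inner e) (gram g'.inner e') (mapIn f e e') (alongIn f N e e') ε
      (mapInDomain f e e') e'.target where
  metric :=
    have h := isMetricOn_gram_riemannian he g
    { isOpen := isOpen_mapInDomain hf.contMDiff.continuous
      contDiffOn := h.contDiffOn.mono Set.inter_subset_left
      symm := fun y hy => h.symm y hy.1
      nondegenerate := fun y hy => h.nondegenerate y hy.1 }
  metric' := isMetricOn_gram he' g'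
  pos y hy u hu := gram_pos he g hy.1 hu
  mapsTo y hy := e'.map_source hy.2
  contDiffOn := contDiffOn_mapIn he he' hf.contMDiff
  contDiffOn_normal := contDiffOn_alongIn he he' hN.contMDiff
  pullback_eq y hy u v := by
    rw [fderiv_mapIn he he' hf.contMDiff hy, fderiv_mapIn he he' hf.contMDiff hy, mapIn,
      gram_mfderiv he' _ hy.2, hf.pullback_eq]
    rfl
  sign := hN.sign
  unit y hy := by
    rw [alongIn, mapIn, gram_mfderiv he' _ hy.2, hN.unit]
  normal y hy u := by
    rw [fderiv_mapIn he he' hf.contMDiff hy, alongIn, mapIn, gram_mfderiv he' _ hy.2, hN.normal]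

omit [ChartedSpace (Eu n) M] [IsManifold (𝓡 n) ∞ M] in
lemma angle_eq (he' : e' ∈ charts m M') (V : ∀ x : M', TangentSpace (𝓡 m) x) {y : Eu n}
    (hy : y ∈ mapInDomain f e e') :
    angle g' f N V (e.symm y) = gram g'.inner e' (mapIn f e e' y)
      (fieldIn V e' (mapIn f e e' y)) (alongIn f N e e' y) := by
  rw [mapIn, fieldIn_apply V hy.2, alongIn, gram_mfderiv he' _ hy.2, angle]

omit [ChartedSpace (Eu n) M] [IsManifold (𝓡 n) ∞ M] [IsManifold (𝓡 m) ∞ M'] in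
lemma normalDeriv_eq (he' : e' ∈ charts m M') {σ : M' → ℝ} (hσ : ContMDiff (𝓡 m) 𝓘(ℝ, ℝ) ∞ σ)
    {y : Eu n} (hy : y ∈ mapInDomain f e e') :
    normalDeriv f N σ (e.symm y)
      = fderiv ℝ (fun x => σ (e'.symm x)) (mapIn f e e' y) (alongIn f N e e' y) := by
  have h1 := (mdifferentiable_of_mem_charts he').mdifferentiableAt_symm (e'.map_source hy.2)
  have h2' : HasMFDerivAt (𝓡 m) 𝓘(ℝ, ℝ) σ (e'.symm (e' (f (e.symm y)))) _ :=
    ((hσ _).mdifferentiableAt (by simp)).hasMFDerivAt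
  have h3 : HasMFDerivAt (𝓡 m) 𝓘(ℝ, ℝ) (fun x => σ (e'.symm x)) (e' (f (e.symm y))) _ :=
    h2'.comp _ h1.hasMFDerivAt
  have h : ∀ q : M', q = f (e.symm y) → ∀ a : Eu m, (mfderiv (𝓡 m) 𝓘(ℝ, ℝ) σ q a : ℝ)
      = mfderiv (𝓡 m) 𝓘(ℝ, ℝ) σ (f (e.symm y)) a := by
    rintro q rfl a
    rfl
  rw [mapIn, ← mfderiv_eq_fderiv, h3.mfderiv, alongIn, normalDeriv]
  refine Eq.trans ?_ (h _ (e'.left_inv hy.2) _).symm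
  exact (congrArg (fun a : TangentSpace (𝓡 m) (f (e.symm y)) =>
    (mfderiv (𝓡 m) 𝓘(ℝ, ℝ) σ (f (e.symm y)) a : ℝ)) (mfderiv_symm_mfderiv he' hy.2 _)).symm

end Charts

/-! ### Mean curvature and constancy on connected manifolds -/

section Umbilic

lemma hessian_congr {E : Type*} [NormedAddCommGroup E] [NormedSpace ℝ E]
    {G : E → E →L[ℝ] E →L[ℝ] ℝ} {φ ψ : E → ℝ} {y : E} (h : φ =ᶠ[nhds y] ψ) (u v : E) :
    hessian G φ y u v = hessian G ψ y u v := by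
  rw [hessian, hessian, h.fderiv.fderiv_eq, h.fderiv_eq]

/-- The Weingarten operator at an umbilic point is a multiple of the identity. -/
lemma IsMetricOn.weingarten_eq {E F : Type*} [NormedAddCommGroup E] [NormedSpace ℝ E]
    [FiniteDimensional ℝ E] [NormedAddCommGroup F] [NormedSpace ℝ F]
    {G : E → E →L[ℝ] E →L[ℝ] ℝ} {U : Set E} (hG : IsMetricOn G U)
    {Gbar : F → F →L[ℝ] F →L[ℝ] ℝ} {f N : E → F} {y : E} (hy : y ∈ U) {μ : ℝ}
    (hμ : ∀ u v, secondForm Gbar f N y u v = μ * G y u v) (u : E) :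
    weingarten G Gbar f N y u = μ • u := by
  rw [← hG.inverse_apply hy (μ • u), weingarten]
  congr 1
  ext v
  rw [map_smul, smul_apply, smul_eq_mul, ← hμ]
  rfl

variable {n m : ℕ}
  {M : Type*} [TopologicalSpace M] [ChartedSpace (Eu n) M] [IsManifold (𝓡 n) ∞ M]
  {M' : Type*} [TopologicalSpace M'] [ChartedSpace (Eu m) M'] [IsManifold (𝓡 m) ∞ M']

omit [IsManifold (𝓡 n) ∞ M] [IsManifold (𝓡 m) ∞ M'] in
lemma mem_mapInDomain_chartAt (f : M → M') (p : M) :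
    chartAt (Eu n) p p ∈ mapInDomain f (chartAt (Eu n) p) (chartAt (Eu m) (f p)) := by
  refine ⟨mem_chart_target _ p, ?_⟩
  rw [Set.mem_preimage, Set.mem_preimage, (chartAt (Eu n) p).left_inv (mem_chart_source _ p)]
  exact mem_chart_source _ (f p)

/-- A function whose differential vanishes in charts is constant on a connected manifold. -/
lemma exists_eq_const [ConnectedSpace M] {f : M → M'} (hf : Continuous f) {ψ : M → ℝ}
    (h : ∀ e ∈ charts n M, ∀ e' ∈ charts m M', ∀ y ∈ mapInDomain f e e',
      DifferentiableAt ℝ (fun z => ψ (e.symm z)) y ∧ fderiv ℝ (fun z => ψ (e.symm z)) y = 0) :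
    ∃ r, ∀ p, ψ p = r := by
  have hloc : IsLocallyConstant ψ := by
    rw [IsLocallyConstant.iff_eventually_eq]
    intro p
    let e := chartAt (Eu n) p
    let e' := chartAt (Eu m) (f p)
    have he : e ∈ charts n M := IsManifold.chart_mem_maximalAtlas p
    have he' : e' ∈ charts m M' := IsManifold.chart_mem_maximalAtlas (f p)
    -- A coordinate ball is connected, so a vanishing derivative gives constancy on it.
    obtain ⟨r, hr, hball⟩ := Metric.isOpen_iff.1 (isOpen_mapInDomain (e := e) (e' := e') hf) _
      (mem_mapInDomain_chartAt f p)
    have hconst : ∀ y ∈ Metric.ball (e p) r, ψ (e.symm y) = ψ (e.symm (e p)) := fun y hy =>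
      Metric.isOpen_ball.is_const_of_fderiv_eq_zero
      (convex_ball (e p) r).isPreconnected
      (fun y hy => (h e he e' he' y (hball hy)).1.differentiableWithinAt)
      (fun y hy => (h e he e' he' y (hball hy)).2)
      hy (Metric.mem_ball_self hr)
    have hcont : ContinuousAt e p := e.continuousAt (mem_chart_source _ p)
    filter_upwards [e.open_source.mem_nhds (mem_chart_source _ p),
      hcont (Metric.ball_mem_nhds (e p) hr)] with q hq hqb
    have := hconst _ hqb
    simpa only [e.left_inv hq, e.left_inv (mem_chart_source _ p)] using this
  obtain ⟨p₀⟩ : Nonempty M := inferInstance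
  exact ⟨ψ p₀, fun p => hloc.apply_eq_of_preconnectedSpace p p₀⟩

variable {g : RiemannianMetric n M} {g' : SemiRiemannianMetric m M'} {f : M → M'}
  {N : ∀ p : M, TangentSpace (𝓡 m) (f p)} {ε : ℝ} {μ : M → ℝ}

/-- The mean curvature of a totally umbilic hypersurface. -/
lemma meanCurvature_eq (hn : n ≠ 0)
    (hμ : ∀ e ∈ charts n M, ∀ e' ∈ charts m M', ∀ y ∈ e.target,
      f (e.symm y) ∈ e'.source → ∀ u v : Eu n,
        secondForm (gram g'.inner e') (mapIn f e e') (alongIn f N e e') y u v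
          = μ (e.symm y) * gram g.inner e y u v) (p : M) :
    meanCurvature g g' f N ε p = ε * μ p := by
  have he : chartAt (Eu n) p ∈ charts n M := IsManifold.chart_mem_maximalAtlas p
  have he' : chartAt (Eu m) (f p) ∈ charts m M' := IsManifold.chart_mem_maximalAtlas (f p)
  have hp := mem_mapInDomain_chartAt (n := n) (m := m) f p
  have hW := (isMetricOn_gram_riemannian he g).weingarten_eq hp.1
    (hμ _ he _ he' _ hp.1 hp.2)
  rw [(chartAt (Eu n) p).left_inv (mem_chart_source _ p)] at hW
  have hn' : (n : ℝ) ≠ 0 := Nat.cast_ne_zero.2 hn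
  simp only [meanCurvature, hW, PiLp.smul_apply, PiLp.single_apply, if_true,
    smul_eq_mul, mul_one, Finset.sum_const, Finset.card_univ, Fintype.card_fin, nsmul_eq_mul]
  field_simp

lemma contMDiff_angle (hf : IsIsometricImmersion g g' f) (hN : IsUnitNormal (n := n) g' f N ε)
    {V : ∀ x : M', TangentSpace (𝓡 m) x} {σ : M' → ℝ} (hV : IsConformalField g' V σ) :
    ContMDiff (𝓡 n) 𝓘(ℝ, ℝ) ∞ (angle g' f N V) := by
  intro p
  have he : chartAt (Eu n) p ∈ charts n M := IsManifold.chart_mem_maximalAtlas p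
  have he' : chartAt (Eu m) (f p) ∈ charts m M' := IsManifold.chart_mem_maximalAtlas (f p)
  have hp := mem_mapInDomain_chartAt (n := n) (m := m) f p
  have h := (isHypersurfaceOn he he' hf hN).contDiffAt_angle (isConformalOn he' hV) hp
  refine ((h.contMDiffAt.comp p (contMDiffAt_of_mem_maximalAtlas he
    (mem_chart_source _ p)))).congr_of_eventuallyEq ?_
  filter_upwards [(chartAt (Eu n) p).open_source.mem_nhds (mem_chart_source _ p),
    (hf.contMDiff.continuous.continuousAt (x := p))
      ((chartAt (Eu m) (f p)).open_source.mem_nhds (mem_chart_source _ (f p)))] with q hq hq'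
  have hqd : chartAt (Eu n) p q ∈ mapInDomain f (chartAt (Eu n) p) (chartAt (Eu m) (f p)) := by
    refine ⟨(chartAt (Eu n) p).map_source hq, ?_⟩
    rw [Set.mem_preimage, (chartAt (Eu n) p).left_inv hq]
    exact hq'
  rw [Function.comp_apply, ← angle_eq he' V hqd, (chartAt (Eu n) p).left_inv hq]

end Umbilic

end SemiRiem

end

/-! ### Gluing the local results -/

theorem proposition1 (n : ℕ) (hn : 2 ≤ n)
    {M : Type*} [TopologicalSpace M] [ChartedSpace (SemiRiem.Eu n) M] [IsManifold (𝓡 n) ∞ M]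
    [ConnectedSpace M]
    {Mbar : Type*} [TopologicalSpace Mbar] [ChartedSpace (SemiRiem.Eu (n + 1)) Mbar]
    [IsManifold (𝓡 (n + 1)) ∞ Mbar]
    (g : SemiRiem.RiemannianMetric n M) (gbar : SemiRiem.SemiRiemannianMetric (n + 1) Mbar)
    (c : ℝ) (hc : SemiRiem.HasConstantSectionalCurvature gbar c)
    (f : M → Mbar) (hf : SemiRiem.IsIsometricImmersion g gbar f)
    (N : ∀ p : M, TangentSpace (𝓡 (n + 1)) (f p)) (ε : ℝ)
    (hN : SemiRiem.IsUnitNormal (n := n) gbar f N ε)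
    (humb : SemiRiem.IsTotallyUmbilic g gbar f N)
    (V : ∀ x : Mbar, TangentSpace (𝓡 (n + 1)) x) (σ : Mbar → ℝ)
    (hV : SemiRiem.IsConformalField gbar V σ) :
    ∃ k b : ℝ,
      (∀ p : M, k = c + ε * SemiRiem.meanCurvature g gbar f N ε p ^ 2) ∧
      (∀ p : M, b = -(SemiRiem.normalDeriv f N σ p
        + ε * σ (f p) * SemiRiem.meanCurvature g gbar f N ε p)) ∧
      SemiRiem.IsSpecialScalarConcircularField g (SemiRiem.angle gbar f N V) k b := by
  open SemiRiem in
  obtain ⟨μ, hμ⟩ := humb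
  have hE : 2 ≤ Module.finrank ℝ (Eu n) := by simpa using hn
  have hdim : Module.finrank ℝ (Eu (n + 1)) = Module.finrank ℝ (Eu n) + 1 := by simp
  have hcont := hf.contMDiff.continuous
  have hεε : ε * ε = 1 := by rcases hN.sign with h | h <;> simp [h]
  obtain ⟨r, hr⟩ : ∃ r, ∀ p, μ p = r := by
    refine exists_eq_const (n := n) (m := n + 1) hcont fun e he e' he' y hy => ?_
    have h := isHypersurfaceOn he he' hf hN
    have hμ' := fun y (hy : y ∈ mapInDomain f e e') => hμ e he e' he' y hy.1 hy.2
    exact ⟨h.differentiableAt_factor hE (μ := fun z => μ (e.symm z)) hμ' hy,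
      h.fderiv_factor_eq_zero hE hdim (hc e' he') (μ := fun z => μ (e.symm z)) hμ' hy⟩
  have hH : ∀ p, meanCurvature g gbar f N ε p = ε * r := fun p => by
    rw [meanCurvature_eq (by omega) hμ, hr]
  have hμr : ∀ e ∈ charts n M, ∀ e' ∈ charts (n + 1) Mbar, ∀ y ∈ mapInDomain f e e', ∀ u v,
      secondForm (gram gbar.inner e') (mapIn f e e') (alongIn f N e e') y u v
        = r * gram g.inner e y u v := fun e he e' he' y hy u v => by
    rw [hμ e he e' he' y hy.1 hy.2, hr]
  have hσ : ∀ (e : OpenPartialHomeomorph M (Eu n)) (e' : OpenPartialHomeomorph Mbar (Eu (n + 1))),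
      ∀ y ∈ mapInDomain f e e', σ (f (e.symm y)) = σ (e'.symm (mapIn f e e' y)) :=
    fun e e' y hy => by rw [mapIn, e'.left_inv hy.2]
  obtain ⟨b, hb⟩ : ∃ b, ∀ p, -(normalDeriv f N σ p + r * σ (f p)) = b := by
    refine exists_eq_const (n := n) (m := n + 1) hcont fun e he e' he' y hy => ?_
    have h := isHypersurfaceOn he he' hf hN
    have hV' := isConformalOn he' hV
    have hev : (fun z => -(normalDeriv f N σ (e.symm z) + r * σ (f (e.symm z)))) =ᶠ[nhds y]
        fun z => -(fderiv ℝ (fun x => σ (e'.symm x)) (mapIn f e e' z) (alongIn f N e e' z)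
          + r * σ (e'.symm (mapIn f e e' z))) := by
      filter_upwards [(isOpen_mapInDomain hcont).mem_nhds hy] with z hz
      rw [normalDeriv_eq he' hV.contMDiff_factor hz, hσ e e' z hz]
    refine ⟨?_, hev.fderiv_eq.trans
      (h.fderiv_potential_eq_zero hE hdim (hc e' he') (hμr e he e' he') hV' hy)⟩
    exact ((h.contDiffAt_potential hV' hy r).differentiableAt (by simp)).congr_of_eventuallyEq hev
  have hA := contMDiff_angle hf hN hV
  refine ⟨c + ε * r ^ 2, b, fun p => ?_, fun p => ?_, hA, ?_, fun e he y hy u v => ?_⟩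
  · rw [hH]
    linear_combination (-ε * r ^ 2) * hεε
  · rw [hH, ← hb p]
    linear_combination (r * σ (f p)) * hεε
  · exact (contMDiff_const.mul hA).add contMDiff_const
  -- The Hessian identity is required in every chart of `M`, but it involves no chart of the ambient
  -- space, so any one around the image point will do.
  · let e' := chartAt (Eu (n + 1)) (f (e.symm y))
    have he' : e' ∈ charts (n + 1) Mbar := IsManifold.chart_mem_maximalAtlas _
    have hyd : y ∈ mapInDomain f e e' := ⟨hy, mem_chart_source _ (f (e.symm y))⟩
    have h := isHypersurfaceOn he he' hf hN
    have hev : (fun z => angle gbar f N V (e.symm z)) =ᶠ[nhds y] fun z =>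
        gram gbar.inner e' (mapIn f e e' z) (fieldIn V e' (mapIn f e e' z))
          (alongIn f N e e' z) := by
      filter_upwards [(isOpen_mapInDomain hcont).mem_nhds hyd] with z hz
      exact angle_eq he' V hz
    rw [hessian_congr hev,
      h.hessian_angle hE hdim (hc e' he') (hμr e he e' he') (isConformalOn he' hV) hyd,
      angle_eq he' V hyd, ← hb (e.symm y), normalDeriv_eq he' hV.contMDiff_factor hyd,
      hσ e e' y hyd]
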